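/- Let $\Theta\subseteq(0,\infty)$ have non-empty interior. For $\vartheta\in\Theta$ let $X_t=\sum_{i=1}^{N_t}\varepsilon_i$, $t\ge 0$, where under $\mathbb P_\vartheta$ the process $(N_t)$ is a homogeneous Poisson process with intensity $\vartheta$ and the $\varepsilon_i$ are i.i.d. uniform on $\{-1,1\}$ and independent of $(N_t)$. For $0<\Delta\le T$ let $\mathbb P_\vartheta^{T,\Delta}$ be the law on $\mathbb Z^{\lfloor T/\Delta\rfloor}$ of $\boldsymbol X=(X_\Delta,X_{2\Delta},\dots,X_{\lfloor T/\Delta\rfloor\Delta})$ under $\mathbb P_\vartheta$. For $T,\Delta>0$ put $$I_{T,\Delta}(\vartheta)=T\Delta\,\mathbb E_\vartheta\Big[\big(h_\Delta(\vartheta,X_\Delta)+(\vartheta\Delta)^{-1}|X_\Delta|-1\big)^2\Big],\qquad h_\Delta(\vartheta,k)=\frac{\mathcal I_{|k|+1}(\vartheta\Delta)}{\mathcal I_{|k|}(\vartheta\Delta)},$$ where $\mathcal I_\nu(x)=\sum_{m\ge0}\frac{(x/2)^{2m+\nu}}{m!\,(\nu+m)!}$ for $\nu\in\mathbb N$. Let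 $0<\Delta_T\le T$ for all $T>0$ and suppose that $\Delta_T\to\Delta_\infty\in(0,\infty)$ as $T\to\infty$. Then, for every $\vartheta\in\Theta$, $$\frac{I_{T,\Delta_T}(\vartheta)}{I_{T,\Delta_\infty}(\vartheta)}\to1\quad\text{as }T\to\infty,$$ and the experiments $\{\mathbb P_\theta^{T,\Delta_T},\theta\in\Theta\}$ are locally asymptotically normal at $\vartheta$ both with normalisation $J_T=I_{T,\Delta_T}(\vartheta)$ and with normalisation $J_T=I_{T,\Delta_\infty}(\vartheta)$. That is: $J_T>0$ for all $T>0$, and there are random variables $\xi_T=\xi_T(\boldsymbol X)$, converging in distribution to $\mathcal N(0,1)$ under $\mathbb P_\vartheta^{T,\Delta_T}$ as $T\to\infty$, and for each $v\in\mathbb R$ random variables $r_T=r_T(v,\boldsymbol X)$, converging to $0$ in probability under $\mathbb P_\vartheta^{T,\Delta_T}$, such that for every $T>0$ with $\vartheta+vJ_T^{-1/2}\in\Theta$, $$\frac{d\mathbb P^{T,\Delta_T}_{\vartheta+vJ_T^{-1/2}}}{d\mathbb P^{T,\Delta_T}_{\vartheta}}(\boldsymbol X)=\exp\Big(v\,\xi_T-\tfrac12v^2+r_T\Big)\qquad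 \mathbb P_\vartheta^{T,\Delta_T}\text{-almost surely}.$$ -/

import Mathlib

open MeasureTheory ProbabilityTheory Filter Topology Asymptotics
open scoped NNReal ENNReal Nat BoundedContinuousFunction

/-- `N` is a standard homogeneous Poisson process with intensity `ϑ` under `P`: it starts at `0`,
has nondecreasing right-continuous paths with values in `ℕ`, independent increments, and
`N t - N s` is Poisson distributed with parameter `ϑ (t - s)` for `s ≤ t`. -/
structure IsPoissonProcess {Ω : Type*} [MeasurableSpace Ω] (P : Measure Ω) (ϑ : ℝ)
    (N : ℝ≥0 → Ω → ℕ) : Prop where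
  measurable : ∀ t, Measurable (N t)
  zero : ∀ᵐ ω ∂P, N 0 ω = 0
  mono : ∀ᵐ ω ∂P, Monotone fun t => N t ω
  right_continuous : ∀ᵐ ω ∂P, ∀ t, ContinuousWithinAt (fun s => N s ω) (Set.Ici t) t
  indep_increments : HasIndepIncrements N P
  law_increments : ∀ s t, s ≤ t →
    HasLaw (fun ω => N t ω - N s ω) (poissonMeasure (ϑ.toNNReal * (t - s))) P

/-- `ε 0, ε 1, …` are independent, uniformly distributed on `{-1, 1}` under `P`. -/
structure IsSymmetricSigns {Ω : Type*} [MeasurableSpace Ω] (P : Measure Ω)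
    (ε : ℕ → Ω → ℤ) : Prop where
  measurable : ∀ i, Measurable (ε i)
  indep : iIndepFun ε P
  prob_one : ∀ i, P {ω | ε i ω = 1} = 1 / 2
  prob_neg_one : ∀ i, P {ω | ε i ω = -1} = 1 / 2

/-- `X` is, under `P`, a compound Poisson process with intensity `ϑ`, symmetric jumps `±1` and
`X 0 = 0`: there are a Poisson process `N` with intensity `ϑ` and, independent of `N`, a sequence
of independent symmetric signs `ε` such that `X t` is the sum of the first `N t` signs. -/
def IsSymmetricCompoundPoisson {Ω : Type*} [MeasurableSpace Ω] (P : Measure Ω) (ϑ : ℝ)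
    (X : ℝ≥0 → Ω → ℤ) : Prop :=
  ∃ (N : ℝ≥0 → Ω → ℕ) (ε : ℕ → Ω → ℤ),
    IsPoissonProcess P ϑ N ∧ IsSymmetricSigns P ε ∧
    IndepFun (fun ω i => ε i ω) (fun ω t => N t ω) P ∧
    ∀ t ω, X t ω = ∑ i ∈ Finset.range (N t ω), ε i ω

/-- The law on `ℤ ^ ⌊T/Δ⌋` of the observation `(X_Δ, X_{2Δ}, …, X_{⌊T/Δ⌋Δ})`. -/
noncomputable def observationLaw {Ω : Type*} [MeasurableSpace Ω] (P : Measure Ω)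
    (X : ℝ≥0 → Ω → ℤ) (T Δ : ℝ) : Measure (Fin ⌊T / Δ⌋₊ → ℤ) :=
  P.map fun ω i => X (((i : ℕ) + 1 : ℝ) * Δ).toNNReal ω

/-- Local asymptotic normality at `ϑ`, as `T → ∞`, of the family of experiments
`{Q T θ : θ ∈ Θ}`, `T > 0`, with normalisation `I T > 0` (the information).
The random variable `ξ T` does not depend on the direction `v`, the remainder `r T` does. -/
def IsLAN {E : ℝ → Type*} [∀ T, MeasurableSpace (E T)] (Θ : Set ℝ)
    (Q : (T : ℝ) → ℝ → Measure (E T)) (ϑ : ℝ) (I : ℝ → ℝ) : Prop :=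
  (∀ T, 0 < T → 0 < I T) ∧
  ∃ ξ : (T : ℝ) → E T → ℝ,
    (∀ T, Measurable (ξ T)) ∧
    (∀ g : ℝ →ᵇ ℝ, Tendsto (fun T => ∫ x, g (ξ T x) ∂(Q T ϑ)) atTop
      (𝓝 (∫ y, g y ∂(gaussianReal 0 1)))) ∧
    ∀ v : ℝ, ∃ r : (T : ℝ) → E T → ℝ,
      (∀ T, Measurable (r T)) ∧
      (∀ T, 0 < T → ϑ + v / √(I T) ∈ Θ →
        ∀ᵐ x ∂(Q T ϑ), ((Q T (ϑ + v / √(I T))).rnDeriv (Q T ϑ) x).toReal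
          = Real.exp (v * ξ T x - v ^ 2 / 2 + r T x)) ∧
      ∀ δ : ℝ, 0 < δ → Tendsto (fun T => Q T ϑ {x | δ ≤ |r T x|}) atTop (𝓝 0)

/-- The modified Bessel function of the first kind of order `ν ∈ ℕ`. -/
noncomputable def besselI (ν : ℕ) (x : ℝ) : ℝ :=
  ∑' m : ℕ, (x / 2) ^ (2 * m + ν) / ((m ! : ℝ) * ((ν + m)! : ℝ))

/-- `h_Δ(ϑ, k) = I_{|k|+1}(ϑ Δ) / I_{|k|}(ϑ Δ)`. -/
noncomputable def besselRatio (Δ ϑ : ℝ) (k : ℤ) : ℝ :=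
  besselI (k.natAbs + 1) (ϑ * Δ) / besselI k.natAbs (ϑ * Δ)

/-- `I_{T,Δ}(ϑ) = T Δ E[(h_Δ(ϑ, X_Δ) + (ϑ Δ)⁻¹ |X_Δ| - 1)²]`, the expectation being under `P`. -/
noncomputable def scaleInformation {Ω : Type*} [MeasurableSpace Ω] (P : Measure Ω)
    (X : ℝ≥0 → Ω → ℤ) (T Δ ϑ : ℝ) : ℝ :=
  T * Δ * ∫ ω, (besselRatio Δ ϑ (X Δ.toNNReal ω)
    + (ϑ * Δ)⁻¹ * |(X Δ.toNNReal ω : ℝ)| - 1) ^ 2 ∂P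

/-! Observing `X` on the grid amounts to observing its `n = ⌊T/Δ⌋` increments, which are i.i.d. with
mass function `p_x(k) = exp(-x) I_|k|(x)`, `x = ϑΔ`. Shifting `ϑ` by `v/√J` shifts `x` by `δ =
vΔ/√J`, so LAN is a quadratic expansion of an i.i.d. log-likelihood in the smooth family `p_x`,
where `x` itself moves with `T`.

The engine is the identity `∂ₓ B = L B` for `B_k = I_|k|(x)`, with `L` the mean over the two
neighbours (`hasDerivAt_besselZ`). Hence the derivatives of `log p_x` are polynomials in the ratios
`LʲB/B`. Each `L` costs at most a factor of order `1 + |k|`, locally uniformly in `x`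
(`exists_score_bounds`), and all moments of `1 + |k|` are locally bounded
(`skellamPMF_mul_absWeight_pow_le`). Since `L` preserves sums over `ℤ`, the score has mean zero and
its derivative has mean minus the Fisher information.

The law of the summands depends on `T`, so asymptotic normality of the score sum comes from a
quantitative characteristic function estimate (`norm_integral_exp_pow_sub_exp_le`). The rest of the
log-likelihood ratio tends to zero in `L¹` (`exists_integral_abs_llrRemainder_le`), hence in
probability. About `J` this uses only its positivity and `J_T/T → Δ_∞ · fisherInfo (ϑΔ_∞)`, which
holds for both normalisations and also gives their equivalence. -/

/-! ### Modified Bessel functions: series, recurrence, derivative -/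

/-- The entire function `G_a` with `I_a(x) = (x/2)^a G_a((x/2)^2)`. -/
noncomputable def besselSeries (a : ℕ) (y : ℝ) : ℝ :=
  ∑' m : ℕ, y ^ m / ((m ! : ℝ) * ((a + m)! : ℝ))

theorem summable_besselSeries (a : ℕ) (y : ℝ) :
    Summable fun m : ℕ => y ^ m / ((m ! : ℝ) * ((a + m)! : ℝ)) := by
  refine Summable.of_norm_bounded (g := fun m : ℕ => |y| ^ m / (m ! : ℝ))
    (Real.summable_pow_div_factorial |y|) fun m => ?_
  have h1 : (1 : ℝ) ≤ ((a + m)! : ℝ) := by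
    exact_mod_cast Nat.one_le_iff_ne_zero.2 (Nat.factorial_ne_zero _)
  have h2 : (0 : ℝ) < (m ! : ℝ) := by positivity
  rw [norm_div, norm_pow, Real.norm_eq_abs, Real.norm_eq_abs,
    abs_of_pos (show (0 : ℝ) < m ! * (a + m)! by positivity)]
  gcongr
  nlinarith

theorem besselI_eq_besselSeries (a : ℕ) (x : ℝ) :
    besselI a x = (x / 2) ^ a * besselSeries a ((x / 2) ^ 2) := by
  rw [besselI, besselSeries, ← tsum_mul_left]
  refine tsum_congr fun m => ?_
  rw [pow_add, pow_mul]
  ring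

theorem summable_besselI (a : ℕ) (x : ℝ) :
    Summable fun m : ℕ => (x / 2) ^ (2 * m + a) / ((m ! : ℝ) * ((a + m)! : ℝ)) := by
  refine ((summable_besselSeries a ((x / 2) ^ 2)).mul_left ((x / 2) ^ a)).congr fun m => ?_
  rw [pow_add, pow_mul]
  ring

/-- Write `1/(a+m)! = ((a+1) + m)/(a+1+m)!`: the first summand gives `G_{a+1}`, the second, after an
index shift, `y G_{a+2}`. -/
theorem besselSeries_succ_mul (a : ℕ) (y : ℝ) :
    besselSeries a y = (a + 1) * besselSeries (a + 1) y + y * besselSeries (a + 2) y := by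
  have h1 := (summable_besselSeries (a + 1) y).hasSum
  have h2 := (summable_besselSeries (a + 2) y).hasSum.mul_left y
  have h3 : HasSum (fun m : ℕ => m * (y ^ m / ((m ! : ℝ) * ((a + 1 + m)! : ℝ))))
      (y * besselSeries (a + 2) y) := by
    rw [← hasSum_nat_add_iff' 1]
    simp only [Finset.range_one, Finset.sum_singleton, Nat.cast_zero, zero_mul, sub_zero]
    refine h2.congr_fun ?_ |> fun h => h
    intro m
    rw [show a + 1 + (m + 1) = a + 2 + m by ring, Nat.factorial_succ m]
    push_cast
    field_simp
    ring
  have h4 := (h1.mul_left ((a : ℝ) + 1)).add h3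
  rw [besselSeries]
  refine HasSum.tsum_eq (h4.congr_fun ?_)
  intro m
  rw [show a + 1 + m = (a + m) + 1 by ring, Nat.factorial_succ (a + m)]
  push_cast
  field_simp
  ring

theorem hasDerivAt_besselSeries (a : ℕ) (y : ℝ) :
    HasDerivAt (besselSeries a) (besselSeries (a + 1) y) y := by
  -- Any radius beyond `|y|` would do: on this ball the termwise derivatives are dominated by `m
  -- R^(m-1)/m!`.
  set R : ℝ := |y| + 1
  have hy : y ∈ Metric.ball (0 : ℝ) R := by simp [R]
  have hsum : Summable fun m : ℕ => (m : ℝ) * R ^ (m - 1) / (m ! : ℝ) := by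
    rw [← summable_nat_add_iff 1]
    refine (Real.summable_pow_div_factorial R).congr fun m => ?_
    rw [Nat.factorial_succ]
    push_cast
    field_simp
  have h := hasDerivAt_tsum_of_isPreconnected (𝕜 := ℝ)
    (g := fun (m : ℕ) (y : ℝ) => y ^ m / ((m ! : ℝ) * ((a + m)! : ℝ)))
    (g' := fun (m : ℕ) (y : ℝ) => (m : ℝ) * y ^ (m - 1) / ((m ! : ℝ) * ((a + m)! : ℝ)))
    hsum Metric.isOpen_ball (convex_ball (0 : ℝ) R).isPreconnected
    (fun m z _ => (hasDerivAt_pow m z).div_const _) (fun m z hz => ?_) hy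
    (summable_besselSeries a y) hy
  · refine h.congr_deriv ?_
    rw [tsum_eq_zero_add' ]
    · simp only [Nat.cast_zero, zero_mul, zero_div, zero_add, besselSeries]
      refine tsum_congr fun m => ?_
      rw [show a + (m + 1) = a + 1 + m by ring, Nat.factorial_succ]
      push_cast
      field_simp
    · refine (summable_besselSeries (a + 1) y).congr fun m => ?_
      rw [show a + (m + 1) = a + 1 + m by ring, Nat.factorial_succ]
      push_cast
      field_simp
  · have hz' : |z| ≤ R := by
      have := Metric.mem_ball.1 hz
      rw [Real.dist_eq, sub_zero] at this
      exact this.le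
    rw [norm_div, norm_mul, norm_pow, Real.norm_eq_abs, Real.norm_eq_abs, Real.norm_eq_abs,
      abs_of_nonneg (Nat.cast_nonneg m), abs_of_pos (show (0 : ℝ) < m ! * (a + m)! by positivity)]
    have : (1 : ℝ) ≤ ((a + m)! : ℝ) := by
      exact_mod_cast Nat.one_le_iff_ne_zero.2 (Nat.factorial_ne_zero _)
    have h2 : (0 : ℝ) < (m ! : ℝ) := by positivity
    gcongr
    nlinarith

theorem besselI_pos (a : ℕ) {x : ℝ} (hx : 0 < x) : 0 < besselI a x :=
  (summable_besselI a x).tsum_pos (fun m => by positivity) 0 (by positivity)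

theorem besselI_recurrence (a : ℕ) {x : ℝ} (hx : 0 < x) :
    besselI a x = 2 * (a + 1) / x * besselI (a + 1) x + besselI (a + 2) x := by
  rw [besselI_eq_besselSeries, besselI_eq_besselSeries, besselI_eq_besselSeries,
    besselSeries_succ_mul a, pow_succ _ (a + 1), pow_succ]
  field_simp
  ring

/-- In the recurrence multiplied by `x/2`, the right side is `(a+1) I_{a+1}` plus a positive term.
-/
theorem besselI_succ_le (a : ℕ) {x : ℝ} (hx : 0 < x) :
    besselI (a + 1) x ≤ x / 2 * besselI a x := by
  have h := besselI_recurrence a hx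
  have h1 := besselI_pos (a + 1) hx
  have h2 := besselI_pos (a + 2) hx
  rw [h]
  have : x / 2 * (2 * (a + 1) / x * besselI (a + 1) x + besselI (a + 2) x)
    = (a + 1) * besselI (a + 1) x + x / 2 * besselI (a + 2) x := by field_simp
  rw [this]
  have : 0 ≤ (a : ℝ) * besselI (a + 1) x := by positivity
  have : 0 ≤ x / 2 * besselI (a + 2) x := by positivity
  linarith

theorem hasDerivAt_besselI (a : ℕ) {x : ℝ} (hx : 0 < x) :
    HasDerivAt (besselI a) (besselI (a + 1) x + a / x * besselI a x) x := by
  have h0 : HasDerivAt (fun x : ℝ => x / 2) (1 / 2) x := (hasDerivAt_id x).div_const 2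
  have h1 := (h0.pow a).mul ((hasDerivAt_besselSeries a ((x / 2) ^ 2)).comp x (h0.pow 2))
  have : besselI a = (fun x : ℝ => (x / 2) ^ a * besselSeries a ((x / 2) ^ 2)) :=
    funext fun x => besselI_eq_besselSeries a x
  rw [besselI_eq_besselSeries, besselI_eq_besselSeries, this]
  refine h1.congr_deriv ?_
  simp only [Function.comp]
  -- The power rule produces the exponent `a - 1`, truncated at `a = 0`.
  rcases a with _ | a
  · simp; ring
  · simp only [Nat.add_sub_cancel, Pi.pow_apply]
    push_cast
    field_simp
    ring

/-- Every exponent `2m + a` in the series is at least `a`. With `r = e` this absorbs exponential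
weights in `|k|` into a larger argument. -/
theorem pow_mul_besselI_le (a : ℕ) {x r : ℝ} (hx : 0 ≤ x) (hr : 1 ≤ r) :
    r ^ a * besselI a x ≤ besselI a (r * x) := by
  rw [besselI, besselI, ← tsum_mul_left]
  refine ((summable_besselI a x).mul_left _).tsum_le_tsum (fun m => ?_) (summable_besselI a _)
  rw [show r * x / 2 = r * (x / 2) by ring, mul_pow, mul_div_assoc]
  gcongr
  omega

theorem besselI_mono (a : ℕ) {x y : ℝ} (hx : 0 ≤ x) (hxy : x ≤ y) : besselI a x ≤ besselI a y := by
  refine (summable_besselI a x).tsum_le_tsum (fun m => ?_) (summable_besselI a y)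
  gcongr

/-! ### Neighbour averaging on the integers -/

/-- The average of the two neighbouring values of a function on `ℤ`. -/
noncomputable def neighborMean (f : ℤ → ℝ) (k : ℤ) : ℝ := (f (k - 1) + f (k + 1)) / 2

/-- The family `k ↦ I_{|k|}(x)`. -/
noncomputable def besselZ (x : ℝ) (k : ℤ) : ℝ := besselI k.natAbs x

theorem besselZ_pos {x : ℝ} (hx : 0 < x) (k : ℤ) : 0 < besselZ x k := besselI_pos _ hx

theorem neighborMean_besselZ {x : ℝ} (hx : 0 < x) (k : ℤ) :
    neighborMean (besselZ x) k
      = besselI (k.natAbs + 1) x + k.natAbs / x * besselI k.natAbs x := by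
  have key : ∀ a : ℕ, (besselI a x + besselI (a + 2) x) / 2
      = besselI (a + 2) x + ((a + 1 : ℕ) : ℝ) / x * besselI (a + 1) x := by
    intro a
    rw [besselI_recurrence a hx]
    push_cast
    field_simp
    ring
  unfold neighborMean besselZ
  rcases Int.natAbs_eq k with h | h
  · rcases hk : k.natAbs with _ | a
    · rw [hk] at h; subst h; simp
    · rw [hk] at h
      rw [show (k - 1).natAbs = a by omega, show (k + 1).natAbs = a + 2 by omega]
      exact key a
  · rcases hk : k.natAbs with _ | a
    · rw [hk] at h; simp at h; subst h; simp
    · rw [hk] at h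
      rw [show (k - 1).natAbs = a + 2 by omega, show (k + 1).natAbs = a by omega, add_comm]
      exact key a

/-- Differentiation in `x` acts as the linear operator `L`, also at `k = 0`, where both neighbours
equal `I_1`. Further derivatives are therefore powers of `L`. -/
theorem hasDerivAt_besselZ (k : ℤ) {x : ℝ} (hx : 0 < x) :
    HasDerivAt (fun x => besselZ x k) (neighborMean (besselZ x) k) x := by
  rw [neighborMean_besselZ hx]
  exact hasDerivAt_besselI _ hx

theorem hasDerivAt_neighborMean {f : ℝ → ℤ → ℝ} {f' : ℤ → ℝ} {x : ℝ}
    (h : ∀ k, HasDerivAt (fun x => f x k) (f' k) x) (k : ℤ) :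
    HasDerivAt (fun x => neighborMean (f x) k) (neighborMean f' k) x :=
  ((h (k - 1)).add (h (k + 1))).div_const 2

/-! ### Simple walks and the Skellam distribution -/

/-- The number of simple walks on `ℤ` with `d` steps from `0` to `k`. -/
def walkCount : ℕ → ℤ → ℕ
  | 0, k => if k = 0 then 1 else 0
  | d + 1, k => walkCount d (k - 1) + walkCount d (k + 1)

theorem walkCount_eq_zero {d : ℕ} {k : ℤ} (h : ∀ a c : ℕ, a + c = d → k ≠ a - c) :
    walkCount d k = 0 := by
  induction d generalizing k with
  | zero =>
    have := h 0 0 rfl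
    simp at this
    simp [walkCount, this]
  | succ d ih =>
    rw [walkCount, ih, ih]
    · intro a c hac hk
      exact h a (c + 1) (by omega) (by push_cast; omega)
    · intro a c hac hk
      exact h (a + 1) c (by omega) (by push_cast; omega)

theorem walkCount_add_sub (a c : ℕ) : walkCount (a + c) (a - c) = (a + c).choose c := by
  induction hd : a + c generalizing a c with
  | zero =>
    obtain ⟨rfl, rfl⟩ : a = 0 ∧ c = 0 := by omega
    simp [walkCount]
  | succ d ih =>
    rw [walkCount]
    rcases a with _ | a
    · obtain rfl : c = d + 1 := by omega
      rw [walkCount_eq_zero (k := ((0 : ℕ) : ℤ) - (d + 1 : ℕ) - 1) (fun a c hac hk => by omega)]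
      have := ih 0 d (by omega)
      rw [show ((0 : ℕ) : ℤ) - (d + 1 : ℕ) + 1 = (0 : ℕ) - d by push_cast; ring, this]
      simp
    · rw [show ((a + 1 : ℕ) : ℤ) - c - 1 = a - c by push_cast; ring, ih a c (by omega)]
      rcases c with _ | c
      · rw [walkCount_eq_zero (fun a c hac hk => by omega)]
        simp
      · rw [show ((a + 1 : ℕ) : ℤ) - (c + 1 : ℕ) + 1 = (a + 1 : ℕ) - c by push_cast; ring,
          ih (a + 1) c (by omega), Nat.choose_succ_succ, add_comm]

theorem walkCount_two_mul_add_natAbs (m : ℕ) (k : ℤ) :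
    walkCount (2 * m + k.natAbs) k = (2 * m + k.natAbs).choose m := by
  rcases Int.natAbs_eq k with h | h
  · rw [show 2 * m + k.natAbs = m + k.natAbs + m by ring]
    exact (congrArg (walkCount _) (by omega)).trans (walkCount_add_sub (m + k.natAbs) m)
  · rw [show 2 * m + k.natAbs = m + (m + k.natAbs) by ring, Nat.choose_symm_add]
    exact (congrArg (walkCount _) (by omega)).trans (walkCount_add_sub m (m + k.natAbs))

/-- The probability that the sum of `d` symmetric signs equals `k`. -/
noncomputable def walkProb (d : ℕ) (k : ℤ) : ℝ≥0∞ := walkCount d k * 2⁻¹ ^ d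

theorem walkProb_succ (d : ℕ) (k : ℤ) :
    walkProb (d + 1) k = 2⁻¹ * walkProb d (k - 1) + 2⁻¹ * walkProb d (k + 1) := by
  simp only [walkProb, walkCount, pow_succ]
  push_cast
  ring

theorem tsum_walkProb (d : ℕ) : ∑' k, walkProb d k = 1 := by
  induction d with
  | zero =>
    rw [tsum_eq_single 0]
    · simp [walkProb, walkCount]
    · intro k hk
      simp [walkProb, walkCount, hk]
  | succ d ih =>
    simp_rw [walkProb_succ]
    have h1 := (Equiv.subRight (1 : ℤ)).tsum_eq (walkProb d)
    have h2 := (Equiv.addRight (1 : ℤ)).tsum_eq (walkProb d)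
    simp only [Equiv.subRight_apply, Equiv.coe_addRight] at h1 h2
    rw [ENNReal.tsum_add, ENNReal.tsum_mul_left, ENNReal.tsum_mul_left, h1, h2, ih, mul_one,
      ENNReal.inv_two_add_inv_two]

/-- The probability mass function of a symmetric compound Poisson variable with mean number of
jumps `x`. -/
noncomputable def skellamPMF (x : ℝ) (k : ℤ) : ℝ := Real.exp (-x) * besselZ x k

theorem skellamPMF_pos {x : ℝ} (hx : 0 < x) (k : ℤ) : 0 < skellamPMF x k :=
  mul_pos (Real.exp_pos _) (besselZ_pos hx k)

/-- Only walks of length `d = 2m + |k|` end at `k`, and `C(d, m)/d! = 1/(m! (m+|k|)!)` turns the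
Poisson mixture into the Bessel series. -/
theorem hasSum_poisson_mul_walkCount (x : ℝ) (k : ℤ) :
    HasSum (fun d : ℕ => Real.exp (-x) * x ^ d / d ! * (walkCount d k / 2 ^ d))
      (skellamPMF x k) := by
  have hinj : Function.Injective fun m : ℕ => 2 * m + k.natAbs := fun m m' h => by
    simp only at h
    omega
  rw [← hinj.hasSum_iff]
  · refine ((summable_besselI k.natAbs x).hasSum.mul_left (Real.exp (-x))).congr_fun fun m => ?_
    simp only [Function.comp]
    rw [walkCount_two_mul_add_natAbs, Nat.cast_choose ℝ (by omega),
      show 2 * m + k.natAbs - m = k.natAbs + m by omega, div_pow]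
    field_simp
  · intro d hd
    rw [walkCount_eq_zero]
    · simp
    · rintro a c hac hk
      refine hd ⟨min a c, ?_⟩
      simp only
      omega

theorem lintegral_walkProb_poissonMeasure (r : ℝ≥0) (k : ℤ) :
    ∫⁻ d, walkProb d k ∂(poissonMeasure r) = ENNReal.ofReal (skellamPMF r k) := by
  rw [lintegral_countable', ← (hasSum_poisson_mul_walkCount r k).tsum_eq,
    ENNReal.ofReal_tsum_of_nonneg (fun d => by positivity)
      (hasSum_poisson_mul_walkCount r k).summable]
  refine tsum_congr fun d => ?_
  rw [poissonMeasure_singleton, ENNReal.ofReal_mul (by positivity), mul_comm]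
  congr 1
  rw [walkProb, ENNReal.ofReal_div_of_pos (by positivity), ENNReal.ofReal_natCast,
    ENNReal.ofReal_pow (by norm_num), ← ENNReal.inv_pow]
  simp [div_eq_mul_inv]

/-- Total mass one is inherited from the walk probabilities by exchanging the sum over `k` with the
Poisson integral; summing over `k` the Bessel functions then gives `exp x`. -/
theorem tsum_ofReal_skellamPMF {x : ℝ} (hx : 0 ≤ x) :
    ∑' k, ENNReal.ofReal (skellamPMF x k) = 1 := by
  lift x to ℝ≥0 using hx
  simp_rw [← lintegral_walkProb_poissonMeasure]
  rw [← lintegral_tsum fun k => (measurable_of_countable _).aemeasurable]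
  simp [tsum_walkProb]

theorem hasSum_skellamPMF {x : ℝ} (hx : 0 < x) : HasSum (skellamPMF x) 1 := by
  have h := tsum_ofReal_skellamPMF hx.le
  have hs : Summable (skellamPMF x) := by
    refine (ENNReal.summable_toReal (f := fun k => ENNReal.ofReal (skellamPMF x k))
      (by rw [h]; simp)).congr fun k => ?_
    rw [ENNReal.toReal_ofReal (skellamPMF_pos hx k).le]
  rw [← ENNReal.ofReal_tsum_of_nonneg (fun k => (skellamPMF_pos hx k).le) hs,
    ENNReal.ofReal_eq_one] at h
  exact h ▸ hs.hasSum

/-- The law of a symmetric compound Poisson variable with mean number of jumps `x`. -/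
noncomputable def skellamMeasure (x : ℝ) : Measure ℤ :=
  Measure.sum fun k => ENNReal.ofReal (skellamPMF x k) • Measure.dirac k

theorem skellamMeasure_singleton (x : ℝ) (k : ℤ) :
    skellamMeasure x {k} = ENNReal.ofReal (skellamPMF x k) :=
  Measure.sum_smul_dirac_singleton

theorem isProbabilityMeasure_skellamMeasure {x : ℝ} (hx : 0 < x) :
    IsProbabilityMeasure (skellamMeasure x) :=
  (hasSum_skellamPMF hx).isProbabilityMeasure_sum_dirac fun k => (skellamPMF_pos hx k).le

theorem integrable_skellamMeasure_iff {E : Type*} [NormedAddCommGroup E] {x : ℝ} (hx : 0 < x)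
    {f : ℤ → E} :
    Integrable f (skellamMeasure x) ↔ Summable fun k => skellamPMF x k * ‖f k‖ := by
  rw [skellamMeasure, integrable_sum_dirac_iff (by simp)]
  simp_rw [ENNReal.toReal_ofReal (skellamPMF_pos hx _).le]

theorem hasSum_integral_skellamMeasure {x : ℝ} (hx : 0 < x) {f : ℤ → ℝ}
    (hf : Integrable f (skellamMeasure x)) :
    HasSum (fun k => skellamPMF x k * f k) (∫ k, f k ∂(skellamMeasure x)) := by
  have := hasSum_integral_sum_dirac (f := f) (c := fun k => ENNReal.ofReal (skellamPMF x k))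
    (x := fun k : ℤ => k) (by simp) (by
      simpa only [ENNReal.toReal_ofReal (skellamPMF_pos hx _).le] using
        (integrable_skellamMeasure_iff hx).1 hf)
  simpa only [ENNReal.toReal_ofReal (skellamPMF_pos hx _).le, smul_eq_mul] using! this

/-! ### Polynomial weights and bounds for iterated averages -/

/-- The weight `1 + |k|`. -/
def absWeight (k : ℤ) : ℝ := 1 + k.natAbs

theorem one_le_absWeight (k : ℤ) : 1 ≤ absWeight k := by simp [absWeight]

theorem absWeight_pos (k : ℤ) : 0 < absWeight k := zero_lt_one.trans_le (one_le_absWeight k)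

theorem absWeight_le_two_mul {k l : ℤ} (h : l.natAbs ≤ k.natAbs + 1) :
    absWeight l ≤ 2 * absWeight k := by
  have : (l.natAbs : ℝ) ≤ k.natAbs + 1 := by exact_mod_cast h
  have h0 : (0 : ℝ) ≤ k.natAbs := by positivity
  unfold absWeight
  linarith

theorem absWeight_pow_le_exp (j : ℕ) (k : ℤ) :
    absWeight k ^ j ≤ j ! * Real.exp 1 * Real.exp 1 ^ k.natAbs := by
  have h := Real.pow_div_factorial_le_exp (absWeight k) (absWeight_pos k).le j
  rw [div_le_iff₀ (by positivity)] at h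
  refine h.trans_eq ?_
  rw [absWeight, Real.exp_add, ← Real.exp_nat_mul, mul_one]
  ring

/-- Translation invariance of sums over `ℤ`; this is the source of the moment identities for the
score. -/
theorem hasSum_neighborMean {f : ℤ → ℝ} {a : ℝ} (hf : HasSum f a) : HasSum (neighborMean f) a := by
  have h1 := (Equiv.subRight (1 : ℤ)).hasSum_iff.2 hf
  have h2 := (Equiv.addRight (1 : ℤ)).hasSum_iff.2 hf
  have h := (h1.add h2).div_const 2
  rw [add_self_div_two] at h
  exact h.congr_fun fun k => by simp [neighborMean]

theorem neighborMean_nonneg {f : ℤ → ℝ} (hf : ∀ k, 0 ≤ f k) (k : ℤ) : 0 ≤ neighborMean f k :=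
  div_nonneg (add_nonneg (hf _) (hf _)) zero_le_two

theorem neighborMean_besselZ_le {c C x : ℝ} (hc : 0 < c) (hx : x ∈ Set.Icc c C) (k : ℤ) :
    neighborMean (besselZ x) k ≤ (C + c⁻¹) * absWeight k * besselZ x k := by
  have hx0 : 0 < x := hc.trans_le hx.1
  have hB := besselZ_pos hx0 k
  have h1 := besselI_succ_le k.natAbs hx0
  rw [neighborMean_besselZ hx0]
  have h2 : x / 2 ≤ C * absWeight k := by
    have := one_le_absWeight k
    have h3 := hx.2
    nlinarith
  have h3 : (k.natAbs : ℝ) / x ≤ c⁻¹ * absWeight k := by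
    rw [div_eq_inv_mul]
    have := hx.1
    gcongr
    simp [absWeight]
  unfold besselZ at hB ⊢
  nlinarith

/-- Both neighbours are positive, so each is at most twice their mean. -/
theorem besselZ_neighbor_le {c C x : ℝ} (hc : 0 < c) (hx : x ∈ Set.Icc c C) (k : ℤ) :
    besselZ x (k - 1) ≤ 2 * (C + c⁻¹) * absWeight k * besselZ x k ∧
      besselZ x (k + 1) ≤ 2 * (C + c⁻¹) * absWeight k * besselZ x k := by
  have hx0 : 0 < x := hc.trans_le hx.1
  have h := neighborMean_besselZ_le hc hx k
  have h1 := besselZ_pos hx0 (k - 1)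
  have h2 := besselZ_pos hx0 (k + 1)
  unfold neighborMean at h
  constructor <;> linarith

/-- The induction step for bounding `LʲB/B`: one more `L` costs one more power of the weight. The
factor `2 ^ j` comes from comparing weights at adjacent points. -/
theorem neighborMean_le_of_le {c C x M : ℝ} (hc : 0 < c) (hx : x ∈ Set.Icc c C) (hM : 0 ≤ M)
    {f : ℤ → ℝ} {j : ℕ} (hf : ∀ k, f k ≤ M * absWeight k ^ j * besselZ x k) (k : ℤ) :
    neighborMean f k ≤ M * 2 ^ j * (2 * (C + c⁻¹)) * absWeight k ^ (j + 1) * besselZ x k := by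
  have hx0 : 0 < x := hc.trans_le hx.1
  have hC : 0 ≤ C := hx0.le.trans hx.2
  have key : ∀ l : ℤ, l.natAbs ≤ k.natAbs + 1 →
      besselZ x l ≤ 2 * (C + c⁻¹) * absWeight k * besselZ x k →
      f l ≤ M * 2 ^ j * (2 * (C + c⁻¹)) * absWeight k ^ (j + 1) * besselZ x k := by
    intro l hl hB
    refine (hf l).trans ?_
    have hw := absWeight_le_two_mul hl
    have hw0 := (absWeight_pos l).le
    have hB0 := (besselZ_pos hx0 l).le
    have hk0 := (absWeight_pos k).le
    calc M * absWeight l ^ j * besselZ x l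
        ≤ M * (2 * absWeight k) ^ j * (2 * (C + c⁻¹) * absWeight k * besselZ x k) := by gcongr
      _ = _ := by rw [mul_pow]; ring
  have h := besselZ_neighbor_le hc hx k
  have h1 := key (k - 1) (by omega) h.1
  have h2 := key (k + 1) (by omega) h.2
  unfold neighborMean
  linarith

/-! ### The score and its derivatives -/

/-- The ratio `L B / B`, where `B k = I_{|k|}(x)` and `L` is the mean over the neighbours. -/
noncomputable def besselLogDeriv (x : ℝ) (k : ℤ) : ℝ := neighborMean (besselZ x) k / besselZ x k

/-- The ratio `L² B / B`, where `B k = I_{|k|}(x)` and `L` is the mean over the neighbours. -/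
noncomputable def besselRatioTwo (x : ℝ) (k : ℤ) : ℝ :=
  neighborMean (neighborMean (besselZ x)) k / besselZ x k

/-- The ratio `L³ B / B`, where `B k = I_{|k|}(x)` and `L` is the mean over the neighbours. -/
noncomputable def besselRatioThree (x : ℝ) (k : ℤ) : ℝ :=
  neighborMean (neighborMean (neighborMean (besselZ x))) k / besselZ x k

/-- The score `∂ₓ log p_x(k)` of the family `skellamPMF`. -/
noncomputable def score (x : ℝ) (k : ℤ) : ℝ := besselLogDeriv x k - 1

/-- The derivative of the score. -/
noncomputable def scoreDeriv (x : ℝ) (k : ℤ) : ℝ := besselRatioTwo x k - besselLogDeriv x k ^ 2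

/-- The second derivative of the score. -/
noncomputable def scoreDerivTwo (x : ℝ) (k : ℤ) : ℝ :=
  besselRatioThree x k - besselRatioTwo x k * besselLogDeriv x k
    - 2 * besselLogDeriv x k * scoreDeriv x k

/-- The quotient rule in a form that closes up: dividing by `B` reproduces `LB/B`, so all
derivatives of the score stay polynomial in the ratios `LʲB/B`. -/
theorem hasDerivAt_div_besselZ {f : ℝ → ℝ} {f' x : ℝ} (k : ℤ) (hx : 0 < x)
    (hf : HasDerivAt f f' x) :
    HasDerivAt (fun x => f x / besselZ x k)
      (f' / besselZ x k - f x / besselZ x k * besselLogDeriv x k) x := by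
  have hB := (besselZ_pos hx k).ne'
  refine (hf.div (hasDerivAt_besselZ k hx) hB).congr_deriv ?_
  unfold besselLogDeriv
  field_simp

theorem hasDerivAt_score (k : ℤ) {x : ℝ} (hx : 0 < x) :
    HasDerivAt (fun x => score x k) (scoreDeriv x k) x := by
  have h := (hasDerivAt_div_besselZ k hx
    (hasDerivAt_neighborMean (fun k => hasDerivAt_besselZ k hx) k)).sub_const 1
  refine h.congr_deriv ?_
  simp only [scoreDeriv, besselRatioTwo, besselLogDeriv]
  ring

theorem hasDerivAt_scoreDeriv (k : ℤ) {x : ℝ} (hx : 0 < x) :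
    HasDerivAt (fun x => scoreDeriv x k) (scoreDerivTwo x k) x := by
  have h1 := hasDerivAt_div_besselZ k hx (hasDerivAt_neighborMean (hasDerivAt_neighborMean
    (fun k => hasDerivAt_besselZ k hx)) k)
  have h2 := ((hasDerivAt_score k hx).add_const 1).pow 2
  have h3 := h1.sub h2
  refine (h3.congr_of_eventuallyEq (Eventually.of_forall fun x => ?_)).congr_deriv ?_
  · simp [scoreDeriv, besselRatioTwo, score]
  · simp [scoreDerivTwo, besselRatioTwo, besselRatioThree, score]

theorem hasDerivAt_log_skellamPMF (k : ℤ) {x : ℝ} (hx : 0 < x) :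
    HasDerivAt (fun x => Real.log (skellamPMF x k)) (score x k) x := by
  have hB := (besselZ_pos hx k).ne'
  have h1 := ((hasDerivAt_neg x).exp.mul (hasDerivAt_besselZ k hx)).log
    (mul_ne_zero (Real.exp_pos _).ne' hB)
  refine h1.congr_deriv ?_
  have := (Real.exp_pos (-x)).ne'
  simp only [score, besselLogDeriv, Pi.mul_apply]
  field_simp
  ring

/-- Identifies the expression squared in the stated information with the score, so that the
information is `TΔ` times a Fisher information. -/
theorem score_eq {Δ ϑ : ℝ} (h : 0 < ϑ * Δ) (k : ℤ) :
    score (ϑ * Δ) k = besselRatio Δ ϑ k + (ϑ * Δ)⁻¹ * |(k : ℝ)| - 1 := by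
  have hB := (besselI_pos k.natAbs h).ne'
  rw [score, besselLogDeriv, neighborMean_besselZ h, besselRatio, besselZ, Nat.cast_natAbs,
    Int.cast_abs]
  field_simp

/-- If `LʲB/B` has degree `j`, the score and its two derivatives have degrees 1, 2, 3, so they are
bounded by the matching powers of the weight. -/
theorem exists_score_bounds {c C : ℝ} (hc : 0 < c) :
    ∃ K, 0 ≤ K ∧ ∀ x ∈ Set.Icc c C, ∀ k, |score x k| ≤ K * absWeight k ∧
      |scoreDeriv x k| ≤ K * absWeight k ^ 2 ∧ |scoreDerivTwo x k| ≤ K * absWeight k ^ 3 := by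
  rcases lt_or_ge C c with hcC | hcC
  · exact ⟨0, le_rfl, fun x hx => absurd (hx.1.trans hx.2) (not_le.2 hcC)⟩
  obtain ⟨D, hD, h⟩ : ∃ D, 0 ≤ D ∧ ∀ x ∈ Set.Icc c C, ∀ k,
      (0 ≤ besselLogDeriv x k ∧ besselLogDeriv x k ≤ D * absWeight k) ∧
      (0 ≤ besselRatioTwo x k ∧ besselRatioTwo x k ≤ D * absWeight k ^ 2) ∧
      (0 ≤ besselRatioThree x k ∧ besselRatioThree x k ≤ D * absWeight k ^ 3) := by
    have hA : 0 ≤ 2 * (C + c⁻¹) := by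
      have := hc.trans_le hcC
      positivity
    set A := 2 * (C + c⁻¹)
    -- The sum of the constants from one, two and three uses of `neighborMean_le_of_le`, so that a
    -- single `D` serves all orders.
    refine ⟨A + 1 * 2 ^ 0 * A * 2 ^ 1 * A + 1 * 2 ^ 0 * A * 2 ^ 1 * A * 2 ^ 2 * A, by positivity,
      fun x hx k => ?_⟩
    have hx0 : 0 < x := hc.trans_le hx.1
    have hB := besselZ_pos hx0
    have e1 := neighborMean_le_of_le (M := 1) (j := 0) (f := besselZ x) hc hx zero_le_one
      (fun k => by simp)
    have e2 := neighborMean_le_of_le (by exact hc) hx (by positivity) e1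
    have e3 := neighborMean_le_of_le (by exact hc) hx (by positivity) e2
    have n1 := neighborMean_nonneg fun k => (hB k).le
    have n2 := neighborMean_nonneg n1
    have n3 := neighborMean_nonneg n2
    have hw := absWeight_pos k
    refine ⟨⟨div_nonneg (n1 k) (hB k).le, (div_le_iff₀ (hB k)).2 ((e1 k).trans ?_)⟩,
      ⟨div_nonneg (n2 k) (hB k).le, (div_le_iff₀ (hB k)).2 ((e2 k).trans ?_)⟩,
      ⟨div_nonneg (n3 k) (hB k).le, (div_le_iff₀ (hB k)).2 ((e3 k).trans ?_)⟩⟩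
    all_goals
      refine mul_le_mul_of_nonneg_right ?_ (hB k).le
    · simp only [zero_add, pow_one]
      refine mul_le_mul_of_nonneg_right ?_ hw.le
      have h1 : 0 ≤ A * 2 * A := by positivity
      have h2 : 0 ≤ A * 2 * A * 2 ^ 2 * A := by positivity
      simp only [A] at *
      linarith
    · refine mul_le_mul_of_nonneg_right ?_ (by positivity)
      have h2 : 0 ≤ A * 2 * A * 2 ^ 2 * A := by positivity
      simp only [A] at *
      linarith
    · refine mul_le_mul_of_nonneg_right ?_ (by positivity)
      have h2 : 0 ≤ A * 2 * A := by positivity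
      simp only [A] at *
      linarith
  refine ⟨1 + D + (D + D ^ 2) + (D + D * D + 2 * D * (D + D ^ 2)), by positivity, fun x hx k => ?_⟩
  obtain ⟨⟨a0, a1⟩, ⟨b0, b1⟩, ⟨c0, c1⟩⟩ := h x hx k
  have hw := one_le_absWeight k
  have hw0 := absWeight_pos k
  set w := absWeight k
  set σ := besselLogDeriv x k with hσ
  have s1 : |score x k| ≤ (1 + D) * w := by
    rw [score, abs_le]
    constructor <;> nlinarith
  have s2 : |scoreDeriv x k| ≤ (D + D ^ 2) * w ^ 2 := by
    rw [scoreDeriv]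
    refine (abs_sub _ _).trans ?_
    rw [abs_of_nonneg b0, abs_of_nonneg (sq_nonneg _)]
    have : σ ^ 2 ≤ (D * w) ^ 2 := by gcongr
    linarith [mul_pow D w 2]
  have s3 : |scoreDerivTwo x k| ≤ (D + D * D + 2 * D * (D + D ^ 2)) * w ^ 3 := by
    rw [scoreDerivTwo]
    refine (abs_sub _ _).trans ((add_le_add_left (abs_sub _ _) _).trans ?_)
    rw [abs_of_nonneg c0, abs_of_nonneg (mul_nonneg b0 a0), abs_mul,
      abs_of_nonneg (mul_nonneg zero_le_two a0)]
    have t1 : besselRatioTwo x k * σ ≤ (D * w ^ 2) * (D * w) := by gcongr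
    have t2 : 2 * σ * |scoreDeriv x k| ≤ 2 * (D * w) * ((D + D ^ 2) * w ^ 2) := by gcongr
    linarith
  refine ⟨s1.trans ?_, s2.trans ?_, s3.trans ?_⟩
  all_goals
    refine mul_le_mul_of_nonneg_right ?_ (by positivity)
  · have : 0 ≤ (D + D ^ 2) + (D + D * D + 2 * D * (D + D ^ 2)) := by positivity
    linarith
  · have : 0 ≤ 1 + D + (D + D * D + 2 * D * (D + D ^ 2)) := by positivity
    linarith
  · have : 0 ≤ 1 + D + (D + D ^ 2) := by positivity
    linarith

/-! ### Taylor expansion of the log-likelihood -/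

/-- The mean value inequality, applied three times on the segment from `x` to `y`; the sharp factor
`1/6` is not needed. -/
theorem abs_taylor_two_sub_le {f f₁ f₂ f₃ : ℝ → ℝ} {s : Set ℝ} (hs : Convex ℝ s) {M : ℝ}
    (hf : ∀ z ∈ s, HasDerivAt f (f₁ z) z) (hf₁ : ∀ z ∈ s, HasDerivAt f₁ (f₂ z) z)
    (hf₂ : ∀ z ∈ s, HasDerivAt f₂ (f₃ z) z) (hM : ∀ z ∈ s, |f₃ z| ≤ M) {x y : ℝ} (hx : x ∈ s)
    (hy : y ∈ s) :
    |f y - f x - f₁ x * (y - x) - f₂ x * (y - x) ^ 2 / 2| ≤ M * |y - x| ^ 3 := by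
  have hM0 : 0 ≤ M := (abs_nonneg _).trans (hM x hx)
  have hseg : segment ℝ x y ⊆ s := hs.segment_subset hx hy
  have hconv : Convex ℝ (segment ℝ x y) := convex_segment x y
  have hxs : x ∈ segment ℝ x y := left_mem_segment ℝ x y
  have hdist : ∀ z ∈ segment ℝ x y, |z - x| ≤ |y - x| := by
    intro z hz
    rw [segment_eq_uIcc] at hz
    exact Set.abs_sub_left_of_mem_uIcc hz
  have h2 : ∀ z ∈ segment ℝ x y, |f₂ z - f₂ x| ≤ M * |y - x| := fun z hz =>
    (hconv.norm_image_sub_le_of_norm_hasDerivWithin_le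
      (fun u hu => (hf₂ u (hseg hu)).hasDerivWithinAt) (fun u hu => hM u (hseg hu)) hxs hz).trans
      (mul_le_mul_of_nonneg_left (hdist z hz) hM0)
  have h1 : ∀ z ∈ segment ℝ x y, |f₁ z - f₁ x - f₂ x * (z - x)| ≤ M * |y - x| ^ 2 := by
    intro z hz
    have := hconv.norm_image_sub_le_of_norm_hasDerivWithin_le
      (f := fun z => f₁ z - f₁ x - f₂ x * (z - x)) (f' := fun z => f₂ z - f₂ x)
      (fun u hu => HasDerivAt.hasDerivWithinAt (by
        have e := ((hf₁ u (hseg hu)).sub_const (f₁ x)).sub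
          (((hasDerivAt_id u).sub_const x).const_mul (f₂ x))
        exact e.congr_deriv (by ring))) h2 hxs hz
    simp only [sub_self, mul_zero, sub_zero, Real.norm_eq_abs] at this
    calc _ ≤ _ := this
      _ ≤ M * |y - x| * |y - x| := mul_le_mul_of_nonneg_left (hdist z hz) (by positivity)
      _ = _ := by ring
  have h0 := hconv.norm_image_sub_le_of_norm_hasDerivWithin_le
      (f := fun z => f z - f x - f₁ x * (z - x) - f₂ x * (z - x) ^ 2 / 2)
      (f' := fun z => f₁ z - f₁ x - f₂ x * (z - x))
      (fun u hu => HasDerivAt.hasDerivWithinAt (by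
        have e := (((hf u (hseg hu)).sub_const (f x)).sub
          (((hasDerivAt_id u).sub_const x).const_mul (f₁ x))).sub
          (((((hasDerivAt_id u).sub_const x).pow 2).const_mul (f₂ x)).div_const 2)
        refine e.congr_deriv ?_
        simp
        ring)) h1 hxs (right_mem_segment ℝ x y)
  simp only [sub_self, mul_zero, sub_zero, Real.norm_eq_abs, ne_eq, OfNat.ofNat_ne_zero,
    not_false_eq_true, zero_pow, zero_div] at h0
  calc _ ≤ _ := h0
    _ = _ := by ring

theorem exists_abs_log_skellamPMF_taylor_le {c C : ℝ} (hc : 0 < c) :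
    ∃ K, 0 ≤ K ∧ ∀ x ∈ Set.Icc c C, ∀ y ∈ Set.Icc c C, ∀ k,
      |Real.log (skellamPMF y k) - Real.log (skellamPMF x k) - score x k * (y - x)
        - scoreDeriv x k * (y - x) ^ 2 / 2| ≤ K * absWeight k ^ 3 * |y - x| ^ 3 := by
  obtain ⟨K, hK, h⟩ := exists_score_bounds (C := C) hc
  refine ⟨K, hK, fun x hx y hy k => ?_⟩
  exact abs_taylor_two_sub_le (convex_Icc c C)
    (fun z hz => hasDerivAt_log_skellamPMF k (hc.trans_le hz.1))
    (fun z hz => hasDerivAt_score k (hc.trans_le hz.1))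
    (fun z hz => hasDerivAt_scoreDeriv k (hc.trans_le hz.1)) (fun z hz => (h z hz k).2.2) hx hy

/-! ### Moments, Fisher information and its continuity -/

/-- The weight is at most a constant times `e^|k|`, which `pow_mul_besselI_le` absorbs by passing
from `x` to `e x`. The majorant sums to a multiple of `exp (e x)`, so all moments are locally
bounded in `x`. -/
theorem skellamPMF_mul_absWeight_pow_le (j : ℕ) {x : ℝ} (hx : 0 < x) (k : ℤ) :
    skellamPMF x k * absWeight k ^ j ≤ j ! * Real.exp 1 * besselZ (Real.exp 1 * x) k := by
  have h1 := absWeight_pow_le_exp j k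
  have h2 := pow_mul_besselI_le k.natAbs hx.le (Real.one_le_exp zero_le_one)
  have h3 : skellamPMF x k ≤ besselZ x k :=
    mul_le_of_le_one_left (besselZ_pos hx k).le (Real.exp_le_one_iff.2 (by linarith))
  calc skellamPMF x k * absWeight k ^ j
      ≤ besselZ x k * (j ! * Real.exp 1 * Real.exp 1 ^ k.natAbs) := 
        mul_le_mul h3 h1 (pow_nonneg (absWeight_pos k).le j) (besselZ_pos hx k).le
    _ = j ! * Real.exp 1 * (Real.exp 1 ^ k.natAbs * besselZ x k) := by ring
    _ ≤ _ := by gcongr; exact h2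

theorem hasSum_besselZ {x : ℝ} (hx : 0 < x) : HasSum (besselZ x) (Real.exp x) := by
  have h := (hasSum_skellamPMF hx).mul_left (Real.exp x)
  rw [mul_one] at h
  refine h.congr_fun fun k => ?_
  rw [skellamPMF, ← mul_assoc, ← Real.exp_add]
  simp

theorem integrable_of_abs_le_absWeight {x : ℝ} (hx : 0 < x) {f : ℤ → ℝ} {K : ℝ} {j : ℕ}
    (hf : ∀ k, |f k| ≤ K * absWeight k ^ j) : Integrable f (skellamMeasure x) := by
  rw [integrable_skellamMeasure_iff hx]
  refine Summable.of_nonneg_of_le (fun k => by have := skellamPMF_pos hx k; positivity)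
    (fun k => ?_) ((hasSum_besselZ (x := Real.exp 1 * x) (by positivity)).summable.mul_left
      (K * (j ! * Real.exp 1)))
  have hK : 0 ≤ K := by
    have := (abs_nonneg _).trans (hf k)
    exact nonneg_of_mul_nonneg_left this (pow_pos (absWeight_pos k) j)
  have hp := (skellamPMF_pos hx k).le
  calc skellamPMF x k * ‖f k‖ ≤ skellamPMF x k * (K * absWeight k ^ j) := by gcongr; exact hf k
    _ = K * (skellamPMF x k * absWeight k ^ j) := by ring
    _ ≤ K * (j ! * Real.exp 1 * besselZ (Real.exp 1 * x) k) := 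
      mul_le_mul_of_nonneg_left (skellamPMF_mul_absWeight_pow_le j hx k) hK
    _ = _ := by ring

theorem integrable_absWeight_pow {x : ℝ} (hx : 0 < x) (j : ℕ) :
    Integrable (fun k => absWeight k ^ j) (skellamMeasure x) :=
  integrable_of_abs_le_absWeight (K := 1) (j := j) hx fun k => by
    rw [abs_of_nonneg (pow_nonneg (absWeight_pos k).le j), one_mul]

theorem integral_absWeight_pow_le {x C : ℝ} (hx : 0 < x) (hxC : x ≤ C) (j : ℕ) :
    ∫ k, absWeight k ^ j ∂(skellamMeasure x)
      ≤ j ! * Real.exp 1 * Real.exp (Real.exp 1 * C) := by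
  have h1 := hasSum_integral_skellamMeasure hx (integrable_absWeight_pow hx j)
  have h2 := (hasSum_besselZ (x := Real.exp 1 * x) (by positivity)).mul_left (j ! * Real.exp 1)
  refine (hasSum_le (fun k => skellamPMF_mul_absWeight_pow_le j hx k) h1 h2).trans ?_
  gcongr

theorem integral_abs_le_of_abs_le_absWeight {x C : ℝ} (hx : 0 < x) (hxC : x ≤ C) {f : ℤ → ℝ}
    {K : ℝ} {j : ℕ} (hK : 0 ≤ K) (hf : ∀ k, |f k| ≤ K * absWeight k ^ j) :
    ∫ k, |f k| ∂(skellamMeasure x) ≤ K * (j ! * Real.exp 1 * Real.exp (Real.exp 1 * C)) := by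
  calc ∫ k, |f k| ∂(skellamMeasure x) ≤ ∫ k, K * absWeight k ^ j ∂(skellamMeasure x) :=
        integral_mono (integrable_of_abs_le_absWeight hx hf).abs
          ((integrable_absWeight_pow hx j).const_mul K) hf
    _ = K * ∫ k, absWeight k ^ j ∂(skellamMeasure x) := integral_const_mul _ _
    _ ≤ _ := by gcongr; exact integral_absWeight_pow_le hx hxC j

theorem abs_score_pow_le {x K : ℝ} {k : ℤ} (h : |score x k| ≤ K * absWeight k) (j : ℕ) :
    |score x k ^ j| ≤ K ^ j * absWeight k ^ j := by
  rw [abs_pow, ← mul_pow]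
  gcongr

theorem integrable_score_pow {x : ℝ} (hx : 0 < x) (j : ℕ) :
    Integrable (fun k => score x k ^ j) (skellamMeasure x) := by
  obtain ⟨K, hK, h⟩ := exists_score_bounds (C := x) hx
  exact integrable_of_abs_le_absWeight hx fun k =>
    abs_score_pow_le (h x ⟨le_rfl, le_rfl⟩ k).1 j

theorem integrable_score {x : ℝ} (hx : 0 < x) : Integrable (score x) (skellamMeasure x) := by
  simpa using integrable_score_pow hx 1

theorem integrable_scoreDeriv_pow {x : ℝ} (hx : 0 < x) (j : ℕ) :
    Integrable (fun k => scoreDeriv x k ^ j) (skellamMeasure x) := by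
  obtain ⟨K, hK, h⟩ := exists_score_bounds (C := x) hx
  refine integrable_of_abs_le_absWeight (K := K ^ j) (j := 2 * j) hx fun k => ?_
  rw [abs_pow, pow_mul, ← mul_pow]
  gcongr
  exact (h x ⟨le_rfl, le_rfl⟩ k).2.1

theorem integrable_scoreDeriv {x : ℝ} (hx : 0 < x) :
    Integrable (scoreDeriv x) (skellamMeasure x) := by
  simpa using integrable_scoreDeriv_pow hx 1

/-- The Fisher information of the family `skellamPMF`. -/
noncomputable def fisherInfo (x : ℝ) : ℝ := ∫ k, score x k ^ 2 ∂(skellamMeasure x)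

/-- Pointwise `p · score = L p - p`, and `L` preserves the sum. -/
theorem integral_score {x : ℝ} (hx : 0 < x) : ∫ k, score x k ∂(skellamMeasure x) = 0 := by
  have h1 := hasSum_integral_skellamMeasure hx (integrable_score hx)
  have h2 := (hasSum_neighborMean (hasSum_skellamPMF hx)).sub (hasSum_skellamPMF hx)
  rw [sub_self] at h2
  refine h1.unique (h2.congr_fun fun k => ?_)
  have hB := (besselZ_pos hx k).ne'
  simp only [score, besselLogDeriv, skellamPMF, neighborMean]
  field_simp

/-- Pointwise `p · (scoreDeriv + score²) = L²p - 2 L p + p`, which sums to `1 - 2 + 1 = 0`. -/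
theorem integral_scoreDeriv {x : ℝ} (hx : 0 < x) :
    ∫ k, scoreDeriv x k ∂(skellamMeasure x) = -fisherInfo x := by
  have h1 := hasSum_integral_skellamMeasure hx
    ((integrable_scoreDeriv hx).add (integrable_score_pow hx 2))
  have e1 := hasSum_neighborMean (hasSum_skellamPMF hx)
  have e2 := hasSum_neighborMean e1
  have h2 := (e2.sub (e1.mul_left 2)).add (hasSum_skellamPMF hx)
  have h3 := h1.unique (h2.congr_fun fun k => by
    have hB := (besselZ_pos hx k).ne'
    simp only [Pi.add_apply, scoreDeriv, score, besselRatioTwo, besselLogDeriv, skellamPMF,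
      neighborMean]
    field_simp
    ring)
  simp only [Pi.add_apply] at h3
  rw [integral_add (integrable_scoreDeriv hx) (integrable_score_pow hx 2)] at h3
  rw [fisherInfo]
  linarith

/-- The score is `I_{n+1}/I_n + n/x - 1` at `n ≥ 0`, positive once `n > x`, and every integer
carries positive mass. -/
theorem fisherInfo_pos {x : ℝ} (hx : 0 < x) : 0 < fisherInfo x := by
  have h := hasSum_integral_skellamMeasure hx (integrable_score_pow hx 2)
  have hn : ∀ k, 0 ≤ skellamPMF x k * score x k ^ 2 := fun k =>
    mul_nonneg (skellamPMF_pos hx k).le (sq_nonneg _)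
  obtain ⟨n, hn'⟩ := exists_nat_gt x
  have hs : 0 < score x n := by
    have hB := besselZ_pos hx n
    have h1 := besselI_pos (n + 1) hx
    rw [score, besselLogDeriv, neighborMean_besselZ hx, sub_pos, lt_div_iff₀ hB]
    simp only [besselZ, Int.natAbs_natCast] at hB ⊢
    have : 1 < (n : ℝ) / x := (one_lt_div hx).2 hn'
    nlinarith
  refine lt_of_lt_of_le ?_ (le_hasSum h (n : ℤ) fun k _ => hn k)
  have := skellamPMF_pos hx n
  positivity

/-- Dominated convergence for the series over `k`; near `x` the majorant is the Bessel sum at `e ·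
2x`. -/
theorem continuousAt_fisherInfo {x : ℝ} (hx : 0 < x) : ContinuousAt fisherInfo x := by
  have hmem : Set.Icc (x / 2) (2 * x) ∈ 𝓝 x := Icc_mem_nhds (by linarith) (by linarith)
  obtain ⟨K, hK, h⟩ := exists_score_bounds (c := x / 2) (C := 2 * x) (by linarith)
  have hval : ∀ y, 0 < y → fisherInfo y = ∑' k, skellamPMF y k * score y k ^ 2 := fun y hy =>
    (hasSum_integral_skellamMeasure hy (integrable_score_pow hy 2)).tsum_eq.symm
  have hev : (fun y => ∑' k, skellamPMF y k * score y k ^ 2) =ᶠ[𝓝 x] fisherInfo := by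
    filter_upwards [lt_mem_nhds hx] with y hy using (hval y hy).symm
  refine Tendsto.congr' hev ?_
  rw [hval x hx]
  refine tendsto_tsum_of_dominated_convergence
    (bound := fun k => K ^ 2 * (2 ! * Real.exp 1 * besselZ (Real.exp 1 * (2 * x)) k)) ?_ ?_ ?_
  · exact ((hasSum_besselZ (by positivity)).summable.mul_left _).mul_left _
  · intro k
    have h1 : ContinuousAt (fun y => skellamPMF y k) x :=
      ((Real.continuous_exp.comp continuous_neg).continuousAt).mul
        (hasDerivAt_besselZ k hx).continuousAt
    exact h1.mul ((hasDerivAt_score k hx).continuousAt.pow 2)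
  · filter_upwards [hmem] with y hy k
    have hy0 : 0 < y := lt_of_lt_of_le (by linarith) hy.1
    have hp := (skellamPMF_pos hy0 k).le
    rw [Real.norm_eq_abs, abs_mul, abs_of_nonneg hp]
    calc skellamPMF y k * |score y k ^ 2| ≤ skellamPMF y k * (K ^ 2 * absWeight k ^ 2) := by
          gcongr
          exact abs_score_pow_le (h y hy k).1 2
      _ = K ^ 2 * (skellamPMF y k * absWeight k ^ 2) := by ring
      _ ≤ K ^ 2 * (2 ! * Real.exp 1 * besselZ (Real.exp 1 * y) k) := 
          mul_le_mul_of_nonneg_left (skellamPMF_mul_absWeight_pow_le 2 hy0 k) (by positivity)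
      _ ≤ _ := by
          gcongr
          exact besselI_mono _ (by positivity) (by have := hy.2; gcongr)

/-! ### Block sums of random signs -/

theorem IsSymmetricSigns.isProbabilityMeasure {Ω : Type*} [MeasurableSpace Ω] {P : Measure Ω}
    {ε : ℕ → Ω → ℤ} (h : IsSymmetricSigns P ε) : IsProbabilityMeasure P :=
  h.indep.isProbabilityMeasure

theorem IsSymmetricSigns.ae_eq_one_or {Ω : Type*} [MeasurableSpace Ω] {P : Measure Ω}
    {ε : ℕ → Ω → ℤ} (h : IsSymmetricSigns P ε) (i : ℕ) : ∀ᵐ ω ∂P, ε i ω = 1 ∨ ε i ω = -1 := by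
  have := h.isProbabilityMeasure
  have hm : MeasurableSet ({ω | ε i ω = 1} ∪ {ω | ε i ω = -1}) :=
    (h.measurable i (measurableSet_singleton 1)).union (h.measurable i (measurableSet_singleton _))
  have h1 : P ({ω | ε i ω = 1} ∪ {ω | ε i ω = -1}) = 1 := by
    rw [measure_union ?_ (show MeasurableSet {ω | ε i ω = -1} from
      h.measurable i (measurableSet_singleton (-1))), h.prob_one, h.prob_neg_one,
      ENNReal.add_halves]
    rw [Set.disjoint_left]
    intro ω h1 h2
    simp only [Set.mem_ofPred_eq] at h1 h2
    omega
  exact (prob_compl_eq_zero_iff hm).2 h1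

/-- Splitting on the last sign reproduces the recursion of `walkProb`. -/
theorem IsSymmetricSigns.measure_sum_Ico_eq {Ω : Type*} [MeasurableSpace Ω] {P : Measure Ω}
    {ε : ℕ → Ω → ℤ} (h : IsSymmetricSigns P ε) (c d : ℕ) (k : ℤ) :
    P {ω | ∑ i ∈ Finset.Ico c (c + d), ε i ω = k} = walkProb d k := by
  have := h.isProbabilityMeasure
  induction d generalizing k with
  | zero =>
    by_cases hk : k = 0
    · simp [hk, walkProb, walkCount]
    · simp [walkProb, walkCount, hk, Ne.symm hk]
  | succ d ih =>
    have hi : IndepFun (fun ω => ∑ i ∈ Finset.Ico c (c + d), ε i ω) (ε (c + d)) P := by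
      have := h.indep.indepFun_finsetSum_of_notMem h.measurable
        (s := Finset.Ico c (c + d)) (i := c + d) (by simp)
      convert this using 1
      ext ω
      simp
    have hS : Measurable fun ω => ∑ i ∈ Finset.Ico c (c + d), ε i ω :=
      Finset.measurable_fun_sum _ fun i _ => h.measurable i
    set S := fun ω => ∑ i ∈ Finset.Ico c (c + d), ε i ω with hSdef
    have hset : {ω | ∑ i ∈ Finset.Ico c (c + (d + 1)), ε i ω = k} =ᵐ[P]
        ((S ⁻¹' {k - 1} ∩ ε (c + d) ⁻¹' {1}) ∪ (S ⁻¹' {k + 1} ∩ ε (c + d) ⁻¹' {-1}) : Set Ω) := by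
      filter_upwards [h.ae_eq_one_or (c + d)] with ω hω
      apply propext
      change (∑ i ∈ Finset.Ico c (c + d + 1), ε i ω = k) ↔
        (S ω = k - 1 ∧ ε (c + d) ω = 1) ∨ (S ω = k + 1 ∧ ε (c + d) ω = -1)
      rw [Finset.sum_Ico_succ_top (by omega)]
      simp only [hSdef]
      omega
    rw [measure_congr hset, measure_union _ ((hS (measurableSet_singleton _)).inter
      (h.measurable _ (measurableSet_singleton _))),
      hi.measure_inter_preimage_eq_mul _ _ (measurableSet_singleton _) (measurableSet_singleton _),
      hi.measure_inter_preimage_eq_mul _ _ (measurableSet_singleton _) (measurableSet_singleton _),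
      walkProb_succ, ← ih, ← ih]
    · have e1 : P (ε (c + d) ⁻¹' {1}) = 2⁻¹ := by rw [← one_div]; exact h.prob_one _
      have e2 : P (ε (c + d) ⁻¹' {-1}) = 2⁻¹ := by rw [← one_div]; exact h.prob_neg_one _
      rw [e1, e2, mul_comm, mul_comm _ (2⁻¹ : ℝ≥0∞)]
      rfl
    · rw [Set.disjoint_left]
      rintro ω ⟨_, h1⟩ ⟨_, h2⟩
      simp only [Set.mem_preimage, Set.mem_singleton_iff] at h1 h2
      omega

theorem IsSymmetricSigns.measure_forall_sum_Ico_eq {Ω : Type*} [MeasurableSpace Ω]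
    {P : Measure Ω} {ε : ℕ → Ω → ℤ} (h : IsSymmetricSigns P ε) {c : ℕ → ℕ} (hc : Monotone c)
    (k : ℕ → ℤ) (n : ℕ) :
    P {ω | ∀ j < n, ∑ i ∈ Finset.Ico (c j) (c (j + 1)), ε i ω = k j}
      = ∏ j ∈ Finset.range n, walkProb (c (j + 1) - c j) (k j) := by
  have := h.isProbabilityMeasure
  induction n with
  | zero => simp
  | succ n ih =>
    have hi := h.indep.indepFun_finset (Finset.range (c n)) (Finset.Ico (c n) (c (n + 1)))
      (by
        rw [Finset.disjoint_left]
        intro i h1 h2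
        simp only [Finset.mem_range, Finset.mem_Ico] at h1 h2
        omega) h.measurable
    -- The event on earlier blocks, read off the coordinates below `c n`; the default `0` is never
    -- reached, since `c (j + 1) ≤ c n` for `j < n`.
    let A : Set (Finset.range (c n) → ℤ) := {e | ∀ j < n,
      ∑ i ∈ Finset.Ico (c j) (c (j + 1)), (if hi : i ∈ Finset.range (c n) then e ⟨i, hi⟩ else 0)
        = k j}
    let B : Set (Finset.Ico (c n) (c (n + 1)) → ℤ) := {e | ∑ i, e i = k n}
    have hset : {ω | ∀ j < n + 1, ∑ i ∈ Finset.Ico (c j) (c (j + 1)), ε i ω = k j}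
        = {ω | ∀ j < n, ∑ i ∈ Finset.Ico (c j) (c (j + 1)), ε i ω = k j}
          ∩ {ω | ∑ i ∈ Finset.Ico (c n) (c (n + 1)), ε i ω = k n} := by
      ext ω
      simp only [Set.mem_ofPred_eq, Set.mem_inter_iff, Nat.forall_lt_succ_right]
    have hA : {ω | ∀ j < n, ∑ i ∈ Finset.Ico (c j) (c (j + 1)), ε i ω = k j}
        = (fun ω (i : Finset.range (c n)) => ε i ω) ⁻¹' A := by
      ext ω
      simp only [Set.mem_ofPred_eq, Set.mem_preimage, A]
      refine forall₂_congr fun j hj => ?_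
      rw [Finset.sum_congr rfl]
      intro i hi
      have h1 := (Finset.mem_Ico.1 hi).2
      have h2 : c (j + 1) ≤ c n := hc (by omega)
      rw [dif_pos (Finset.mem_range.2 (h1.trans_le h2))]
    have hB : {ω | ∑ i ∈ Finset.Ico (c n) (c (n + 1)), ε i ω = k n}
        = (fun ω (i : Finset.Ico (c n) (c (n + 1))) => ε i ω) ⁻¹' B := by
      ext ω
      simp only [Set.mem_ofPred_eq, Set.mem_preimage, B]
      rw [← Finset.sum_coe_sort (Finset.Ico (c n) (c (n + 1)))]
    have hlast := h.measure_sum_Ico_eq (c n) (c (n + 1) - c n) (k n)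
    rw [Nat.add_sub_cancel' (hc n.le_succ)] at hlast
    rw [hset, hA, hB, hi.measure_inter_preimage_eq_mul _ _ (Set.to_countable _).measurableSet
      (Set.to_countable _).measurableSet, ← hA, ← hB, ih, hlast, Finset.prod_range_succ]

/-- Extension of a finite sequence by zero. -/
def extendZero {α : Type*} [Zero α] {n : ℕ} (m : Fin n → α) (l : ℕ) : α :=
  if h : l < n then m ⟨l, h⟩ else 0

theorem lintegral_prod_pi {ι : Type*} [Fintype ι] {α : ι → Type*} [∀ i, MeasurableSpace (α i)]
    (μ : ∀ i, Measure (α i)) [∀ i, IsProbabilityMeasure (μ i)] {f : ∀ i, α i → ℝ≥0∞}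
    (hf : ∀ i, Measurable (f i)) :
    ∫⁻ x, ∏ i, f i (x i) ∂(Measure.pi μ) = ∏ i, ∫⁻ y, f i y ∂(μ i) := by
  refine (lintegral_prod_eq_prod_lintegral_of_indepFun (μ := Measure.pi μ) Finset.univ
    (fun i (x : ∀ i, α i) => f i (x i)) (iIndepFun_pi fun i => (hf i).aemeasurable)
    (fun i => (hf i).comp (measurable_pi_apply i))).trans ?_
  refine Finset.prod_congr rfl fun i _ => ?_
  exact (measurePreserving_eval μ i).lintegral_comp (hf i)

/-- Given the block lengths `M = m`, the block sums are independent walks of `m j` steps. Averaging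
the product of `walkProb` over independent Poisson lengths factorises into Skellam masses. -/
theorem map_blockSums_eq_pi {Ω : Type*} [MeasurableSpace Ω] {P : Measure Ω} {ε : ℕ → Ω → ℤ}
    (h : IsSymmetricSigns P ε) {n : ℕ} {M : Ω → Fin n → ℕ} (hM : Measurable M) {r : ℝ≥0}
    (hlaw : P.map M = Measure.pi fun _ => poissonMeasure r)
    (hind : IndepFun (fun ω i => ε i ω) M P) {W : Ω → Fin n → ℤ} (hW : AEMeasurable W P)
    (hWM : ∀ᵐ ω ∂P, ∀ j, W ω j = ∑ i ∈ Finset.Ico (∑ l ∈ Finset.range j, extendZero (M ω) l)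
      (∑ l ∈ Finset.range (j + 1), extendZero (M ω) l), ε i ω) (hr : 0 < (r : ℝ)) :
    P.map W = Measure.pi fun _ => skellamMeasure r := by
  have := isProbabilityMeasure_skellamMeasure hr
  refine Measure.ext_of_singleton fun k => ?_
  rw [Measure.map_apply_of_aemeasurable hW (measurableSet_singleton k), Measure.pi_singleton]
  let c : (Fin n → ℕ) → ℕ → ℕ := fun m j => ∑ l ∈ Finset.range j, extendZero m l
  have hc : ∀ m, Monotone (c m) := fun m => monotone_nat_of_le_succ fun j => by
    simp only [c, Finset.sum_range_succ]
    omega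
  let E : (Fin n → ℕ) → Set (ℕ → ℤ) := fun m => {e | ∀ j < n,
    ∑ i ∈ Finset.Ico (c m j) (c m (j + 1)), e i = extendZero k j}
  have hEm : ∀ m, MeasurableSet (E m) := by
    intro m
    have : E m = ⋂ j, ⋂ (_ : j < n), {e | ∑ i ∈ Finset.Ico (c m j) (c m (j + 1)), e i
        = extendZero k j} := by
      ext e
      simp [E]
    rw [this]
    refine MeasurableSet.iInter fun j => MeasurableSet.iInter fun _ => ?_
    exact measurableSet_eq_fun
      (Finset.measurable_fun_sum _ fun i _ => measurable_pi_apply i) measurable_const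
  have hset : (W ⁻¹' {k} : Set Ω) =ᵐ[P]
      (⋃ m, (fun ω i => ε i ω) ⁻¹' (E m) ∩ M ⁻¹' {m} : Set Ω) := by
    filter_upwards [hWM] with ω hω
    apply propext
    change W ω = k ↔ ω ∈ ⋃ m, (fun ω i => ε i ω) ⁻¹' (E m) ∩ M ⁻¹' {m}
    simp only [Set.mem_iUnion, Set.mem_inter_iff, Set.mem_preimage, Set.mem_singleton_iff,
      exists_eq_right', E, Set.mem_ofPred_eq, c]
    constructor
    · rintro rfl j hj
      rw [extendZero, dif_pos hj, hω]
    · intro hj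
      ext j
      rw [hω, hj j j.2, extendZero, dif_pos j.2]
  have hE : ∀ m, P ((fun ω i => ε i ω) ⁻¹' (E m)) = ∏ j, walkProb (m j) (k j) := by
    intro m
    refine (h.measure_forall_sum_Ico_eq (hc m) (extendZero k) n).trans ?_
    rw [Finset.prod_range]
    refine Finset.prod_congr rfl fun j _ => ?_
    simp [c, Finset.sum_range_succ, extendZero]
  have hεm : Measurable fun ω i => ε i ω := measurable_pi_lambda _ h.measurable
  rw [measure_congr hset, measure_iUnion]
  · calc ∑' m, P ((fun ω i => ε i ω) ⁻¹' (E m) ∩ M ⁻¹' {m})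
        = ∑' m, (∏ j, walkProb (m j) (k j)) * (Measure.pi fun _ => poissonMeasure r) {m} := by
          refine tsum_congr fun m => ?_
          rw [hind.measure_inter_preimage_eq_mul _ _ (hEm m) (measurableSet_singleton m), hE,
            ← hlaw, Measure.map_apply hM (measurableSet_singleton m)]
      _ = ∫⁻ m, ∏ j, walkProb (m j) (k j) ∂(Measure.pi fun _ => poissonMeasure r) :=
          (lintegral_countable' _).symm
      _ = ∏ j, ∫⁻ d, walkProb d (k j) ∂(poissonMeasure r) :=
          lintegral_prod_pi (f := fun j d => walkProb d (k j)) _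
            fun j => measurable_of_countable _
      _ = _ := by
          simp_rw [lintegral_walkProb_poissonMeasure, skellamMeasure_singleton]
  · intro m m' hmm
    rw [Function.onFun, Set.disjoint_left]
    rintro ω ⟨_, h1⟩ ⟨_, h2⟩
    exact hmm (h1.symm.trans h2)
  · exact fun m => (hεm (hEm m)).inter (hM (measurableSet_singleton m))

/-! ### Increments of the observed process -/

/-- The observation times `j Δ`. -/
noncomputable def gridTime (Δ : ℝ) (j : ℕ) : ℝ≥0 := (j * Δ).toNNReal

theorem gridTime_mono {Δ : ℝ} (hΔ : 0 < Δ) : Monotone (gridTime Δ) := fun i j hij => by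
  unfold gridTime
  gcongr

theorem gridTime_succ_sub {Δ : ℝ} (hΔ : 0 < Δ) (j : ℕ) :
    gridTime Δ (j + 1) - gridTime Δ j = Δ.toNNReal := by
  unfold gridTime
  push_cast
  rw [add_one_mul, Real.toNNReal_add (by positivity) hΔ.le, add_tsub_cancel_left]

theorem IsSymmetricCompoundPoisson.isProbabilityMeasure {Ω : Type*} [MeasurableSpace Ω]
    {P : Measure Ω} {ϑ : ℝ} {X : ℝ≥0 → Ω → ℤ} (hX : IsSymmetricCompoundPoisson P ϑ X) :
    IsProbabilityMeasure P := by
  obtain ⟨N, ε, -, hε, -⟩ := hX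
  exact hε.isProbabilityMeasure

theorem IsSymmetricCompoundPoisson.measurable {Ω : Type*} [MeasurableSpace Ω]
    {P : Measure Ω} {ϑ : ℝ} {X : ℝ≥0 → Ω → ℤ} (hX : IsSymmetricCompoundPoisson P ϑ X) (t : ℝ≥0) :
    Measurable (X t) := by
  obtain ⟨N, ε, hN, hε, -, hsum⟩ := hX
  have h : Measurable fun p : ℕ × Ω => ∑ i ∈ Finset.range p.1, ε i p.2 :=
    measurable_from_prod_countable_right fun m =>
      Finset.measurable_fun_sum (Finset.range m) fun i _ => hε.measurable i
  rw [show X t = (fun p : ℕ × Ω => ∑ i ∈ Finset.range p.1, ε i p.2) ∘ fun ω => (N t ω, ω) from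
    funext fun ω => hsum t ω]
  exact h.comp ((hN.measurable t).prodMk measurable_id)

theorem IsSymmetricCompoundPoisson.ae_zero {Ω : Type*} [MeasurableSpace Ω]
    {P : Measure Ω} {ϑ : ℝ} {X : ℝ≥0 → Ω → ℤ} (hX : IsSymmetricCompoundPoisson P ϑ X) :
    ∀ᵐ ω ∂P, X 0 ω = 0 := by
  obtain ⟨N, ε, hN, hε, -, hsum⟩ := hX
  filter_upwards [hN.zero] with ω hω
  rw [hsum, hω]
  simp

/-- The increment over a grid cell sums the signs indexed between consecutive values of `N`, so the
increments are block sums whose lengths are the independent Poisson increments of `N`. -/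
theorem IsSymmetricCompoundPoisson.map_increments {Ω : Type*} [MeasurableSpace Ω]
    {P : Measure Ω} {ϑ : ℝ} {X : ℝ≥0 → Ω → ℤ} (hX : IsSymmetricCompoundPoisson P ϑ X)
    (hϑ : 0 < ϑ) {Δ : ℝ} (hΔ : 0 < Δ) (n : ℕ) :
    P.map (fun ω (i : Fin n) => X (gridTime Δ (i + 1)) ω - X (gridTime Δ i) ω)
      = Measure.pi fun _ => skellamMeasure (ϑ * Δ) := by
  have hXm := hX.measurable
  obtain ⟨N, ε, hN, hε, hind, hsum⟩ := hX
  let t := gridTime Δ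
  let M : Ω → Fin n → ℕ := fun ω i => N (t (i + 1)) ω - N (t i) ω
  have hMm : Measurable M := measurable_pi_lambda _ fun i =>
    (hN.measurable _).sub (hN.measurable _)
  have hr : ((ϑ.toNNReal * Δ.toNNReal : ℝ≥0) : ℝ) = ϑ * Δ := by
    rw [NNReal.coe_mul, Real.coe_toNNReal _ hϑ.le, Real.coe_toNNReal _ hΔ.le]
  rw [← hr]
  refine map_blockSums_eq_pi hε hMm (M := M) ?_ ?_ ?_ ?_ ?_
  · have hi := (hN.indep_increments.nat (gridTime_mono hΔ)).precomp
      (g := fun i : Fin n => (i : ℕ)) Fin.val_injective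
    refine (hi.map_fun_eq_pi_map fun i => (measurable_pi_iff.1 hMm i).aemeasurable).trans ?_
    congr
    ext1 i
    rw [(hN.law_increments _ _ (gridTime_mono hΔ (Nat.le_succ i))).map_eq, gridTime_succ_sub hΔ]
  · have hg : Measurable fun (f : ℝ≥0 → ℕ) (i : Fin n) => f (t (i + 1)) - f (t i) :=
      measurable_pi_lambda _ fun i => (measurable_pi_apply _).sub (measurable_pi_apply _)
    exact hind.comp measurable_id hg
  · exact (measurable_pi_lambda _ fun i => (hXm _).sub (hXm _)).aemeasurable
  · filter_upwards [hN.zero, hN.mono] with ω h0 hmono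
    have hcum : ∀ j ≤ n, ∑ l ∈ Finset.range j, extendZero (M ω) l = N (t j) ω := by
      intro j hj
      have h1 := Finset.sum_range_tsub (f := fun j => N (t j) ω)
        (fun a b hab => hmono (gridTime_mono hΔ hab)) j
      have ht0 : t 0 = 0 := by simp [t, gridTime]
      simp only [ht0, h0, Nat.sub_zero] at h1
      rw [← h1]
      refine Finset.sum_congr rfl fun l hl => ?_
      have : l < n := (Finset.mem_range.1 hl).trans_le hj
      rw [extendZero, dif_pos this]
    intro j
    rw [hcum j j.2.le, hcum (j + 1) j.2, hsum, hsum,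
      Finset.sum_Ico_eq_sub _ (hmono (gridTime_mono hΔ (Nat.le_succ j)))]
  · rw [hr]
    positivity

/-- The successive differences of a finite sequence, starting from `0`. -/
def differences {n : ℕ} (y : Fin n → ℤ) (i : Fin n) : ℤ :=
  y i - if (i : ℕ) = 0 then 0 else y ⟨i - 1, by omega⟩

/-- Makes the mass of an observation equal to the product mass of its differences, so likelihoods
can be computed from the increments. -/
theorem differences_injective (n : ℕ) : Function.Injective (differences (n := n)) := by
  intro y z h
  have key : ∀ j (hj : j < n), y ⟨j, hj⟩ = z ⟨j, hj⟩ := by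
    intro j
    induction j with
    | zero =>
      intro hj
      have := congrFun h ⟨0, hj⟩
      simpa [differences] using this
    | succ j ih =>
      intro hj
      have := congrFun h ⟨j + 1, hj⟩
      simp only [differences, Nat.add_eq_zero_iff, one_ne_zero, and_false, if_false,
        Nat.add_sub_cancel, ih (by omega)] at this
      linarith
  ext i
  exact key i i.2

theorem map_differences_observationLaw {Ω : Type*} [MeasurableSpace Ω]
    {P : Measure Ω} {ϑ : ℝ} {X : ℝ≥0 → Ω → ℤ} (hX : IsSymmetricCompoundPoisson P ϑ X)
    (hϑ : 0 < ϑ) (T : ℝ) {Δ : ℝ} (hΔ : 0 < Δ) :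
    (observationLaw P X T Δ).map differences = Measure.pi fun _ => skellamMeasure (ϑ * Δ) := by
  rw [observationLaw, Measure.map_map (measurable_of_countable _)
    (measurable_pi_lambda _ fun i => hX.measurable _), ← hX.map_increments hϑ hΔ]
  refine Measure.map_congr ?_
  filter_upwards [hX.ae_zero] with ω h0
  ext i
  simp only [Function.comp, differences, gridTime]
  push_cast
  by_cases hi : (i : ℕ) = 0
  · simp [hi, h0]
  · rw [if_neg hi, Nat.cast_sub (by omega)]
    simp

theorem map_eval_eq_skellamMeasure {Ω : Type*} [MeasurableSpace Ω]
    {P : Measure Ω} {ϑ : ℝ} {X : ℝ≥0 → Ω → ℤ} (hX : IsSymmetricCompoundPoisson P ϑ X)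
    (hϑ : 0 < ϑ) {Δ : ℝ} (hΔ : 0 < Δ) :
    P.map (X Δ.toNNReal) = skellamMeasure (ϑ * Δ) := by
  have := isProbabilityMeasure_skellamMeasure (mul_pos hϑ hΔ)
  have h := congrArg (Measure.map (Function.eval (0 : Fin 1))) (hX.map_increments hϑ hΔ 1)
  rw [(measurePreserving_eval (fun _ : Fin 1 => skellamMeasure (ϑ * Δ)) 0).map_eq,
    Measure.map_map (measurable_pi_apply _) (measurable_pi_lambda _ fun i => by
      exact (hX.measurable _).sub (hX.measurable _))] at h
  rw [← h]
  refine Measure.map_congr ?_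
  filter_upwards [hX.ae_zero] with ω h0
  simp [gridTime, h0]

theorem scaleInformation_eq {Ω : Type*} [MeasurableSpace Ω]
    {P : Measure Ω} {ϑ : ℝ} {X : ℝ≥0 → Ω → ℤ} (hX : IsSymmetricCompoundPoisson P ϑ X)
    (hϑ : 0 < ϑ) (T : ℝ) {Δ : ℝ} (hΔ : 0 < Δ) :
    scaleInformation P X T Δ ϑ = T * Δ * fisherInfo (ϑ * Δ) := by
  rw [scaleInformation, fisherInfo, ← map_eval_eq_skellamMeasure hX hϑ hΔ,
    integral_map (hX.measurable _).aemeasurable (measurable_of_countable _).aestronglyMeasurable]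
  simp_rw [score_eq (mul_pos hϑ hΔ)]

/-- As `μ` charges every point of a countable space, the ratio of point masses is a density of `ν`.
-/
theorem rnDeriv_ae_eq_div_singleton {E : Type*} [MeasurableSpace E] [Countable E]
    [MeasurableSingletonClass E] (μ ν : Measure E) [IsFiniteMeasure μ] (hμ : ∀ x, μ {x} ≠ 0) :
    ν.rnDeriv μ =ᵐ[μ] fun x => ν {x} / μ {x} := by
  have h : ν = μ.withDensity fun x => ν {x} / μ {x} := by
    refine Measure.ext_of_singleton fun x => ?_
    rw [withDensity_apply _ (measurableSet_singleton x), lintegral_singleton,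
      ENNReal.div_mul_cancel (hμ x) (measure_ne_top μ _)]
  have h2 := Measure.rnDeriv_withDensity μ (f := fun x => ν {x} / μ {x})
    (measurable_of_countable _)
  rwa [← h] at h2

/-! ### A quantitative central limit estimate -/

theorem norm_exp_mul_I_sub_taylor_le (u : ℝ) :
    ‖Complex.exp (u * Complex.I) - (1 + u * Complex.I - (u : ℂ) ^ 2 / 2)‖ ≤ 4 * |u| ^ 3 := by
  have hn : ‖(u : ℂ) * Complex.I‖ = |u| := by simp
  -- For `|u| ≤ 1` the Taylor remainder carries `exp |u| ≤ e < 4`; for `|u| > 1` every term is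
  -- bounded by a multiple of `|u|³`.
  rcases le_or_gt |u| 1 with hu | hu
  · have h := Complex.norm_exp_sub_sum_le_norm_mul_exp ((u : ℂ) * Complex.I) 3
    have e : ∑ m ∈ Finset.range 3, ((u : ℂ) * Complex.I) ^ m / (m ! : ℂ)
        = 1 + u * Complex.I - (u : ℂ) ^ 2 / 2 := by
      simp [Finset.sum_range_succ, mul_pow]
      ring
    rw [e, hn] at h
    refine h.trans ?_
    have h3 : Real.exp |u| ≤ 4 := by
      have := Real.exp_le_exp.2 hu
      have := Real.exp_one_lt_d9
      linarith
    have : 0 ≤ |u| ^ 3 := by positivity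
    nlinarith
  · have h1 : ‖Complex.exp (u * Complex.I)‖ = 1 := Complex.norm_exp_ofReal_mul_I u
    have h2 : ‖1 + (u : ℂ) * Complex.I - (u : ℂ) ^ 2 / 2‖ ≤ 1 + |u| + |u| ^ 2 / 2 := by
      refine (norm_sub_le _ _).trans (add_le_add ((norm_add_le _ _).trans ?_) ?_)
      · rw [hn, norm_one]
      · simp
    refine (norm_sub_le _ _).trans ?_
    rw [h1]
    have h3 : |u| ≤ |u| ^ 3 := by
      have := pow_le_pow_right₀ hu.le (show 1 ≤ 3 by norm_num)
      simpa using this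
    have h4 : |u| ^ 2 ≤ |u| ^ 3 := pow_le_pow_right₀ hu.le (by norm_num)
    linarith

theorem norm_pow_sub_pow_le {a b : ℂ} (ha : ‖a‖ ≤ 1) (hb : ‖b‖ ≤ 1) (n : ℕ) :
    ‖a ^ n - b ^ n‖ ≤ n * ‖a - b‖ := by
  induction n with
  | zero => simp
  | succ n ih =>
    have e : a ^ (n + 1) - b ^ (n + 1) = a ^ n * (a - b) + (a ^ n - b ^ n) * b := by ring
    rw [e]
    refine (norm_add_le _ _).trans ?_
    rw [norm_mul, norm_mul, norm_pow]
    have h1 : ‖a‖ ^ n * ‖a - b‖ ≤ 1 * ‖a - b‖ := by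
      gcongr
      exact pow_le_one₀ (norm_nonneg _) ha
    have h2 : ‖a ^ n - b ^ n‖ * ‖b‖ ≤ (n * ‖a - b‖) * 1 := by gcongr
    push_cast
    linarith

/-- With `w = u²V/2`, the characteristic function is within a third-moment error of `1 - w`, which
is within `w²` of `exp (-w)`; taking `n`-th powers in the unit disc multiplies the error by at most
`n`. The explicit bound allows the law of the summands to vary with `n`. -/
theorem norm_integral_exp_pow_sub_exp_le {E : Type*} [MeasurableSpace E] {μ : Measure E}
    [IsProbabilityMeasure μ] {f : E → ℝ} (hf : Measurable f) (h1 : Integrable f μ)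
    (h2 : Integrable (fun y => f y ^ 2) μ) (h3 : Integrable (fun y => |f y| ^ 3) μ)
    (h0 : ∫ y, f y ∂μ = 0) {u : ℝ} (hu : u ^ 2 * (∫ y, f y ^ 2 ∂μ) / 2 ≤ 1) (n : ℕ) :
    ‖(∫ y, Complex.exp ((u * f y : ℝ) * Complex.I) ∂μ) ^ n
      - Complex.exp ((-(n * (u ^ 2 * (∫ y, f y ^ 2 ∂μ) / 2)) : ℝ))‖
      ≤ n * (4 * |u| ^ 3 * (∫ y, |f y| ^ 3 ∂μ) + (u ^ 2 * (∫ y, f y ^ 2 ∂μ) / 2) ^ 2) := by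
  set V := ∫ y, f y ^ 2 ∂μ with hV
  set w := u ^ 2 * V / 2 with hw
  have hV0 : 0 ≤ V := integral_nonneg fun y => sq_nonneg _
  have hw0 : 0 ≤ w := by positivity
  have hexp : Integrable (fun y => Complex.exp ((u * f y : ℝ) * Complex.I)) μ := by
    refine Integrable.of_bound (C := 1) (by fun_prop) (Eventually.of_forall fun y => ?_)
    rw [Complex.norm_exp_ofReal_mul_I]
  have hφ : ‖∫ y, Complex.exp ((u * f y : ℝ) * Complex.I) ∂μ‖ ≤ 1 := by
    refine (norm_integral_le_of_norm_le_const (C := 1) (Eventually.of_forall fun y => ?_)).trans ?_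
    · rw [Complex.norm_exp_ofReal_mul_I]
    · simp
  have hpoly : Integrable (fun y => (1 : ℂ) + ((u * f y : ℝ) : ℂ) * Complex.I
      - ((u * f y : ℝ) : ℂ) ^ 2 / 2) μ := by
    refine Integrable.sub ((integrable_const _).add ((h1.const_mul u).ofReal.mul_const _)) ?_
    have e : (fun y => ((u * f y : ℝ) : ℂ) ^ 2 / 2)
        = fun y => ((u ^ 2 / 2 * f y ^ 2 : ℝ) : ℂ) := by
      ext y
      push_cast
      ring
    rw [e]
    exact (h2.const_mul (u ^ 2 / 2)).ofReal
  have hint : ∫ y, ((1 : ℂ) + ((u * f y : ℝ) : ℂ) * Complex.I - ((u * f y : ℝ) : ℂ) ^ 2 / 2) ∂μ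
      = ((1 - w : ℝ) : ℂ) := by
    have e : ∀ y, (1 : ℂ) + ((u * f y : ℝ) : ℂ) * Complex.I - ((u * f y : ℝ) : ℂ) ^ 2 / 2
        = ((1 - u ^ 2 / 2 * f y ^ 2 : ℝ) : ℂ) + ((u * f y : ℝ) : ℂ) * Complex.I := by
      intro y
      push_cast
      ring
    simp_rw [e]
    rw [integral_add (((integrable_const _).sub (h2.const_mul _)).ofReal)
      ((h1.const_mul u).ofReal.mul_const _), integral_mul_const, integral_complex_ofReal,
      integral_complex_ofReal,
      integral_const_mul, h0, integral_sub (integrable_const _) (h2.const_mul _),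
      integral_const_mul]
    simp only [integral_const, probReal_univ, smul_eq_mul, mul_one, mul_zero, Complex.ofReal_zero,
      zero_mul, add_zero]
    congr 2
    rw [hw]
    ring
  have hdiff : ‖(∫ y, Complex.exp ((u * f y : ℝ) * Complex.I) ∂μ) - ((1 - w : ℝ) : ℂ)‖
      ≤ 4 * |u| ^ 3 * ∫ y, |f y| ^ 3 ∂μ := by
    rw [← hint, ← integral_sub hexp hpoly, ← integral_const_mul]
    refine norm_integral_le_of_norm_le (h3.const_mul _) (Eventually.of_forall fun y => ?_)
    refine (norm_exp_mul_I_sub_taylor_le _).trans_eq ?_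
    rw [abs_mul, mul_pow]
    ring
  have hdiff2 : ‖((1 - w : ℝ) : ℂ) - Complex.exp ((-w : ℝ))‖ ≤ w ^ 2 := by
    rw [← Complex.ofReal_exp, ← Complex.ofReal_sub, Complex.norm_real, Real.norm_eq_abs,
      abs_sub_comm]
    have := Real.abs_exp_sub_one_sub_id_le (x := -w) (by rw [abs_neg, abs_of_nonneg hw0]; exact hu)
    rw [neg_sq] at this
    convert this using 2
    ring
  have e : Complex.exp ((-(n * w) : ℝ)) = Complex.exp ((-w : ℝ)) ^ n := by
    rw [← Complex.exp_nat_mul]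
    congr 1
    push_cast
    ring
  rw [e]
  refine (norm_pow_sub_pow_le hφ ?_ n).trans ?_
  · rw [← Complex.ofReal_exp, Complex.norm_real, Real.norm_eq_abs, abs_of_pos (Real.exp_pos _)]
    exact Real.exp_le_one_iff.2 (by linarith)
  · gcongr
    calc _ = ‖((∫ y, Complex.exp ((u * f y : ℝ) * Complex.I) ∂μ) - ((1 - w : ℝ) : ℂ))
            + (((1 - w : ℝ) : ℂ) - Complex.exp ((-w : ℝ)))‖ := by congr 1; ring
      _ ≤ _ := (norm_add_le _ _).trans (add_le_add hdiff hdiff2)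

theorem tendsto_of_tendsto_charFun_atTop {ρ : ℝ → ProbabilityMeasure ℝ} {ρ₀ : ProbabilityMeasure ℝ}
    (h : ∀ t, Tendsto (fun T => charFun (ρ T : Measure ℝ) t) atTop
      (𝓝 (charFun (ρ₀ : Measure ℝ) t))) :
    Tendsto ρ atTop (𝓝 ρ₀) :=
  tendsto_of_seq_tendsto fun _ hu =>
    ProbabilityMeasure.tendsto_of_tendsto_charFun fun t => (h t).comp hu

/-! ### Sums of i.i.d. variables and the likelihood remainder -/

theorem integrable_sum_pi {E : Type*} [MeasurableSpace E] {μ : Measure E} [IsProbabilityMeasure μ]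
    {f : E → ℝ} (hf : Integrable f μ) (n : ℕ) :
    Integrable (fun y : Fin n → E => ∑ i, f (y i)) (Measure.pi fun _ => μ) :=
  integrable_finsetSum _ fun i _ =>
    (measurePreserving_eval (fun _ : Fin n => μ) i).integrable_comp_of_integrable hf

theorem integral_sum_pi {E : Type*} [MeasurableSpace E] {μ : Measure E} [IsProbabilityMeasure μ]
    {f : E → ℝ} (hf : Integrable f μ) (n : ℕ) :
    ∫ y : Fin n → E, ∑ i, f (y i) ∂(Measure.pi fun _ => μ) = n * ∫ y, f y ∂μ := by
  refine (integral_finsetSum _ fun i _ =>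
    (measurePreserving_eval (fun _ : Fin n => μ) i).integrable_comp_of_integrable hf).trans ?_
  simp only [Function.comp, Function.eval]
  have : ∀ i : Fin n, ∫ y : Fin n → E, f (y i) ∂(Measure.pi fun _ => μ) = ∫ y, f y ∂μ := by
    intro i
    have hi := measurePreserving_eval (fun _ : Fin n => μ) i
    have e := integral_map (μ := Measure.pi fun _ : Fin n => μ) hi.measurable.aemeasurable
      (f := f) (by rw [hi.map_eq]; exact hf.aestronglyMeasurable)
    rw [hi.map_eq] at e
    exact e.symm
  simp [this]

theorem integral_sq_sum_sub_pi_le {E : Type*} [MeasurableSpace E] {μ : Measure E}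
    [IsProbabilityMeasure μ] {f : E → ℝ} (hf : MemLp f 2 μ) (n : ℕ) :
    Integrable (fun y : Fin n → E => (∑ i, f (y i) - n * ∫ y, f y ∂μ) ^ 2)
        (Measure.pi fun _ => μ) ∧
      ∫ y : Fin n → E, (∑ i, f (y i) - n * ∫ y, f y ∂μ) ^ 2 ∂(Measure.pi fun _ => μ)
        ≤ n * ∫ y, f y ^ 2 ∂μ := by
  have hsum : MemLp (fun y : Fin n → E => ∑ i, f (y i)) 2 (Measure.pi fun _ => μ) :=
    memLp_finsetSum _ fun i _ =>
      hf.comp_measurePreserving (measurePreserving_eval (fun _ : Fin n => μ) i)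
  have hv := variance_sum_pi (μ := fun _ : Fin n => μ) (X := fun _ => f) fun _ => hf
  have hE := integral_sum_pi (hf.integrable one_le_two) n
  refine ⟨(hsum.sub (memLp_const _)).integrable_sq, ?_⟩
  have e : Var[∑ i : Fin n, fun y : Fin n → E => f (y i); Measure.pi fun _ => μ]
      = ∫ y : Fin n → E, (∑ i, f (y i) - n * ∫ y, f y ∂μ) ^ 2 ∂(Measure.pi fun _ => μ) := by
    rw [← hE, ← variance_eq_integral hsum.aestronglyMeasurable.aemeasurable]
    congr 1
    ext y
    simp
  rw [← e, hv]
  simp only [Finset.sum_const, Finset.card_univ, Fintype.card_fin, nsmul_eq_mul]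
  gcongr
  exact variance_le_expectation_sq hf.aestronglyMeasurable

/-- The remainder in the quadratic expansion of the log-likelihood ratio of the increments
between the parameters `x + δ` and `x`, in direction `v`. -/
noncomputable def llrRemainder (x δ v : ℝ) {n : ℕ} (y : Fin n → ℤ) : ℝ :=
  ∑ i, (Real.log (skellamPMF (x + δ) (y i)) - Real.log (skellamPMF x (y i)))
    - δ * ∑ i, score x (y i) + v ^ 2 / 2

/-- Three errors add up: the cubic Taylor remainder, the fluctuation of the sum of `scoreDeriv`
about its mean `-n · fisherInfo x`, and the mismatch between `n δ² · fisherInfo x` and `v²`. `D`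
depends only on the interval, so `x` may vary with `T`. -/
theorem exists_integral_abs_llrRemainder_le {c C : ℝ} (hc : 0 < c) :
    ∃ D, 0 ≤ D ∧ ∀ x ∈ Set.Icc c C, ∀ δ, x + δ ∈ Set.Icc c C → ∀ (n : ℕ) (v : ℝ),
      Integrable (fun y : Fin n → ℤ => llrRemainder x δ v y)
          (Measure.pi fun _ => skellamMeasure x) ∧
        ∫ y : Fin n → ℤ, |llrRemainder x δ v y| ∂(Measure.pi fun _ => skellamMeasure x)
          ≤ D * (n * |δ| ^ 3) + |δ| + |v ^ 2 - n * δ ^ 2 * fisherInfo x| / 2 := by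
  obtain ⟨K, hK, hT⟩ := exists_abs_log_skellamPMF_taylor_le (C := C) hc
  obtain ⟨L, hL, hS⟩ := exists_score_bounds (C := C) hc
  set m : ℕ → ℝ := fun j => j ! * Real.exp 1 * Real.exp (Real.exp 1 * C)
  have hm : ∀ j, 0 ≤ m j := fun j => by positivity
  have hm3 := hm 3
  have hm4 := hm 4
  refine ⟨K * m 3 + L ^ 2 * m 4, by positivity, fun x hx δ hδ n v => ?_⟩
  have hx0 : 0 < x := hc.trans_le hx.1
  have := isProbabilityMeasure_skellamMeasure hx0
  have hw3 := integrable_absWeight_pow hx0 3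
  have hLp : MemLp (scoreDeriv x) 2 (skellamMeasure x) :=
    (memLp_two_iff_integrable_sq (measurable_of_countable _).aestronglyMeasurable).2
      (integrable_scoreDeriv_pow hx0 2)
  obtain ⟨hAi, hA⟩ := integral_sq_sum_sub_pi_le hLp n
  rw [integral_scoreDeriv hx0] at hAi hA
  set A : (Fin n → ℤ) → ℝ := fun y => ∑ i, scoreDeriv x (y i) - n * -fisherInfo x with hAdef
  set G : (Fin n → ℤ) → ℝ := fun y => K * |δ| ^ 3 * ∑ i, absWeight (y i) ^ 3
    + (|δ| ^ 3 * A y ^ 2 + (|δ| + |v ^ 2 - n * δ ^ 2 * fisherInfo x| / 2)) with hG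
  have hbound : ∀ y, |llrRemainder x δ v y| ≤ G y := by
    intro y
    have e : llrRemainder x δ v y = ∑ i, (Real.log (skellamPMF (x + δ) (y i))
        - Real.log (skellamPMF x (y i)) - score x (y i) * δ - scoreDeriv x (y i) * δ ^ 2 / 2)
        + δ ^ 2 / 2 * A y + (v ^ 2 - n * δ ^ 2 * fisherInfo x) / 2 := by
      simp only [llrRemainder, hAdef, Finset.sum_sub_distrib, ← Finset.sum_mul, ← Finset.sum_div]
      ring
    rw [e]
    have h1 : |∑ i, (Real.log (skellamPMF (x + δ) (y i))
        - Real.log (skellamPMF x (y i)) - score x (y i) * δ - scoreDeriv x (y i) * δ ^ 2 / 2)|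
        ≤ K * |δ| ^ 3 * ∑ i, absWeight (y i) ^ 3 := by
      refine (Finset.abs_sum_le_sum_abs _ _).trans ?_
      rw [Finset.mul_sum]
      refine Finset.sum_le_sum fun i _ => ?_
      have := hT x hx (x + δ) hδ (y i)
      rw [add_sub_cancel_left] at this
      refine this.trans_eq (by ring)
    -- With `t = |δ||A|` this is `t/2 ≤ t² + 1` times `|δ|`. It reduces the fluctuation to a
    -- variance of order `n`, contributing `n|δ|³ + |δ|`, which vanishes for `δ` of order
    -- `n^(-1/2)`.
    have h2 : |δ ^ 2 / 2 * A y| ≤ |δ| ^ 3 * A y ^ 2 + |δ| := by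
      rw [abs_mul, abs_of_nonneg (by positivity : 0 ≤ δ ^ 2 / 2), ← sq_abs δ, ← sq_abs (A y)]
      nlinarith [mul_nonneg (abs_nonneg δ) (sq_nonneg (|δ| * |A y| - 1)), abs_nonneg δ,
        mul_nonneg (abs_nonneg δ) (sq_nonneg (|δ| * |A y|))]
    have h3 : |(v ^ 2 - n * δ ^ 2 * fisherInfo x) / 2|
        = |v ^ 2 - n * δ ^ 2 * fisherInfo x| / 2 := by
      rw [abs_div, abs_two]
    have h4 := abs_add_three (∑ i, (Real.log (skellamPMF (x + δ) (y i))
        - Real.log (skellamPMF x (y i)) - score x (y i) * δ - scoreDeriv x (y i) * δ ^ 2 / 2))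
        (δ ^ 2 / 2 * A y) ((v ^ 2 - n * δ ^ 2 * fisherInfo x) / 2)
    rw [h3] at h4
    simp only [hG]
    linarith
  have hG1 : Integrable (fun y : Fin n → ℤ => K * |δ| ^ 3 * ∑ i, absWeight (y i) ^ 3)
      (Measure.pi fun _ => skellamMeasure x) := (integrable_sum_pi hw3 n).const_mul _
  have hG2 : Integrable (fun y => |δ| ^ 3 * A y ^ 2) (Measure.pi fun _ => skellamMeasure x) :=
    hAi.const_mul _
  have hGi : Integrable G (Measure.pi fun _ => skellamMeasure x) :=
    hG1.add (hG2.add (integrable_const _))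
  have hRi : Integrable (fun y : Fin n → ℤ => llrRemainder x δ v y)
      (Measure.pi fun _ => skellamMeasure x) :=
    hGi.mono' (measurable_of_countable _).aestronglyMeasurable
      (Eventually.of_forall fun y => hbound y)
  refine ⟨hRi, (integral_mono hRi.abs hGi hbound).trans ?_⟩
  have hm3' := integral_absWeight_pow_le hx0 hx.2 3
  have hm4' : ∫ k, scoreDeriv x k ^ 2 ∂(skellamMeasure x) ≤ L ^ 2 * m 4 := by
    have := integral_abs_le_of_abs_le_absWeight (f := fun k => scoreDeriv x k ^ 2) (K := L ^ 2)
      (j := 4) hx0 hx.2 (by positivity) fun k => by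
        rw [abs_pow, show absWeight k ^ 4 = (absWeight k ^ 2) ^ 2 by ring, ← mul_pow]
        gcongr
        exact (hS x hx k).2.1
    have e : ∀ k, |scoreDeriv x k ^ 2| = scoreDeriv x k ^ 2 := fun k => abs_of_nonneg (sq_nonneg _)
    simp only [e] at this
    exact this
  set B := |δ| + |v ^ 2 - n * δ ^ 2 * fisherInfo x| / 2 with hB
  have i1 := integral_add hG1 (hG2.add (integrable_const B))
  have i2 := integral_add hG2 (integrable_const B)
  refine (le_of_eq (i1.trans (congrArg (_ + ·) i2))).trans ?_
  rw [integral_const_mul, integral_const_mul, integral_sum_pi hw3, integral_const, probReal_univ,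
    one_smul]
  have e1 : K * |δ| ^ 3 * (n * ∫ k, absWeight k ^ 3 ∂(skellamMeasure x))
      ≤ K * |δ| ^ 3 * (n * m 3) := by gcongr
  have e2 : |δ| ^ 3 * ∫ y, A y ^ 2 ∂(Measure.pi fun _ => skellamMeasure x)
      ≤ |δ| ^ 3 * (n * (L ^ 2 * m 4)) := by
    gcongr
    exact hA.trans (by gcongr)
  have e3 : K * |δ| ^ 3 * (n * m 3) + |δ| ^ 3 * (n * (L ^ 2 * m 4))
      = (K * m 3 + L ^ 2 * m 4) * (n * |δ| ^ 3) := by ring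
  linarith

/-! ### Likelihood ratio and characteristic function of the observation -/

theorem IsSymmetricCompoundPoisson.isProbabilityMeasure_observationLaw {Ω : Type*}
    [MeasurableSpace Ω] {P : Measure Ω} {ϑ : ℝ} {X : ℝ≥0 → Ω → ℤ}
    (hX : IsSymmetricCompoundPoisson P ϑ X) (T Δ : ℝ) :
    IsProbabilityMeasure (observationLaw P X T Δ) := by
  have := hX.isProbabilityMeasure
  exact Measure.isProbabilityMeasure_map
    (measurable_pi_lambda _ fun i => hX.measurable _).aemeasurable

theorem observationLaw_singleton {Ω : Type*} [MeasurableSpace Ω]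
    {P : Measure Ω} {ϑ : ℝ} {X : ℝ≥0 → Ω → ℤ} (hX : IsSymmetricCompoundPoisson P ϑ X)
    (hϑ : 0 < ϑ) (T : ℝ) {Δ : ℝ} (hΔ : 0 < Δ) (y : Fin ⌊T / Δ⌋₊ → ℤ) :
    observationLaw P X T Δ {y}
      = ENNReal.ofReal (∏ i, skellamPMF (ϑ * Δ) (differences y i)) := by
  have := isProbabilityMeasure_skellamMeasure (mul_pos hϑ hΔ)
  have h := congrArg (fun m => m {differences y}) (map_differences_observationLaw hX hϑ T hΔ)
  rw [Measure.map_apply (measurable_of_countable _) (measurableSet_singleton _),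
    ← Set.image_singleton, (differences_injective _).preimage_image, Set.image_singleton,
    Measure.pi_singleton] at h
  rw [h, ENNReal.ofReal_prod_of_nonneg fun i _ => (skellamPMF_pos (mul_pos hϑ hΔ) _).le]
  simp_rw [skellamMeasure_singleton]

theorem rnDeriv_observationLaw {Ω : Type*} [MeasurableSpace Ω]
    {P P' : Measure Ω} {ϑ ϑ' : ℝ} {X X' : ℝ≥0 → Ω → ℤ} (hX : IsSymmetricCompoundPoisson P ϑ X)
    (hX' : IsSymmetricCompoundPoisson P' ϑ' X') (hϑ : 0 < ϑ) (hϑ' : 0 < ϑ') (T : ℝ) {Δ : ℝ}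
    (hΔ : 0 < Δ) :
    ∀ᵐ y ∂(observationLaw P X T Δ),
      ((observationLaw P' X' T Δ).rnDeriv (observationLaw P X T Δ) y).toReal
        = Real.exp (∑ i, (Real.log (skellamPMF (ϑ' * Δ) (differences y i))
            - Real.log (skellamPMF (ϑ * Δ) (differences y i)))) := by
  have := hX.isProbabilityMeasure_observationLaw T Δ
  have hp : ∀ k, 0 < skellamPMF (ϑ * Δ) k := skellamPMF_pos (mul_pos hϑ hΔ)
  have hp' : ∀ k, 0 < skellamPMF (ϑ' * Δ) k := skellamPMF_pos (mul_pos hϑ' hΔ)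
  have hprod : ∀ y : Fin ⌊T / Δ⌋₊ → ℤ, 0 < ∏ i, skellamPMF (ϑ * Δ) (differences y i) :=
    fun y => Finset.prod_pos fun i _ => hp _
  have hprod' : ∀ y : Fin ⌊T / Δ⌋₊ → ℤ, 0 < ∏ i, skellamPMF (ϑ' * Δ) (differences y i) :=
    fun y => Finset.prod_pos fun i _ => hp' _
  filter_upwards [rnDeriv_ae_eq_div_singleton (observationLaw P X T Δ) (observationLaw P' X' T Δ)
    fun y => by
      rw [observationLaw_singleton hX hϑ T hΔ]
      exact (ENNReal.ofReal_pos.2 (hprod y)).ne'] with y hy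
  rw [hy, observationLaw_singleton hX hϑ T hΔ, observationLaw_singleton hX' hϑ' T hΔ,
    ENNReal.toReal_div, ENNReal.toReal_ofReal (hprod y).le, ENNReal.toReal_ofReal (hprod' y).le,
    Finset.sum_sub_distrib, ← Real.log_prod fun i _ => (hp' _).ne',
    ← Real.log_prod fun i _ => (hp _).ne', Real.exp_sub, Real.exp_log (hprod' y),
    Real.exp_log (hprod y)]

theorem charFun_map_score_sum {Ω : Type*} [MeasurableSpace Ω]
    {P : Measure Ω} {ϑ : ℝ} {X : ℝ≥0 → Ω → ℤ} (hX : IsSymmetricCompoundPoisson P ϑ X)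
    (hϑ : 0 < ϑ) (T : ℝ) {Δ : ℝ} (hΔ : 0 < Δ) (a t : ℝ) :
    charFun ((observationLaw P X T Δ).map
        fun y => a * ∑ i, score (ϑ * Δ) (differences y i)) t
      = (∫ k, Complex.exp ((t * a * score (ϑ * Δ) k : ℝ) * Complex.I)
          ∂(skellamMeasure (ϑ * Δ))) ^ ⌊T / Δ⌋₊ := by
  have := isProbabilityMeasure_skellamMeasure (mul_pos hϑ hΔ)
  rw [charFun_apply_real, integral_map (measurable_of_countable _).aemeasurable (by fun_prop)]
  let F : (Fin ⌊T / Δ⌋₊ → ℤ) → ℂ := fun d =>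
    ∏ i, Complex.exp ((t * a * score (ϑ * Δ) (d i) : ℝ) * Complex.I)
  have e : ∀ y : Fin ⌊T / Δ⌋₊ → ℤ,
      Complex.exp (t * ((a * ∑ i, score (ϑ * Δ) (differences y i) : ℝ) : ℂ) * Complex.I)
        = F (differences y) := by
    intro y
    simp only [F]
    rw [← Complex.exp_sum, ← Finset.sum_mul]
    congr 2
    push_cast
    rw [Finset.mul_sum, Finset.mul_sum]
    refine Finset.sum_congr rfl fun i _ => ?_
    ring
  rw [integral_congr_ae (ae_of_all _ e),
    ← integral_map (f := F) (measurable_of_countable _).aemeasurable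
      (measurable_of_countable _).aestronglyMeasurable, map_differences_observationLaw hX hϑ T hΔ]
  refine (integral_fintype_prod_eq_pow
    (fun k => Complex.exp ((t * a * score (ϑ * Δ) k : ℝ) * Complex.I))).trans ?_
  rw [Fintype.card_fin]

/-! ### Limits along `T → ∞` and local asymptotic normality -/

section Asymptotics

variable {ϑ Δ_inf : ℝ} {Δ J : ℝ → ℝ}

theorem tendsto_sq_div_sqrt (hJ : ∀ T, 0 < T → 0 < J T) {κ : ℝ} (hκ : 0 < κ)
    (hJlim : Tendsto (fun T => J T / T) atTop (𝓝 κ)) (hlim : Tendsto Δ atTop (𝓝 Δ_inf)) :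
    Tendsto (fun T => Δ T / √(J T)) atTop (𝓝 0) := by
  have hTJ : Tendsto (fun T => T / J T) atTop (𝓝 κ⁻¹) :=
    (hJlim.inv₀ hκ.ne').congr fun T => inv_div _ _
  have h : Tendsto (fun T => (Δ T / √(J T)) ^ 2) atTop (𝓝 0) := by
    have h1 := ((hlim.pow 2).mul hTJ).mul tendsto_inv_atTop_zero
    rw [mul_zero] at h1
    refine h1.congr' ?_
    filter_upwards [eventually_gt_atTop 0] with T hT
    rw [div_pow, Real.sq_sqrt (hJ T hT).le]
    field_simp
  have h2 := (Real.continuous_sqrt.tendsto 0).comp h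
  rw [Real.sqrt_zero] at h2
  rw [tendsto_zero_iff_abs_tendsto_zero]
  exact h2.congr fun T => Real.sqrt_sq_eq_abs _

/-- Up to the floor, `(T/Δ)(Δ/√J)² = Δ · T/J`. With `κ = Δ_inf · fisherInfo (ϑ * Δ_inf)` the limit
is the inverse Fisher information, so the normalised score sum has asymptotic variance one. -/
theorem tendsto_floor_mul_sq_div_sqrt (hJ : ∀ T, 0 < T → 0 < J T) {κ : ℝ} (hκ : 0 < κ)
    (hJlim : Tendsto (fun T => J T / T) atTop (𝓝 κ)) (hΔ : ∀ T, 0 < T → 0 < Δ T)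
    (hΔ_inf : 0 < Δ_inf) (hlim : Tendsto Δ atTop (𝓝 Δ_inf)) :
    Tendsto (fun T => (⌊T / Δ T⌋₊ : ℝ) * (Δ T / √(J T)) ^ 2) atTop (𝓝 (Δ_inf / κ)) := by
  have hTJ : Tendsto (fun T => T / J T) atTop (𝓝 κ⁻¹) :=
    (hJlim.inv₀ hκ.ne').congr fun T => inv_div _ _
  have hTΔ : Tendsto (fun T => T / Δ T) atTop atTop :=
    tendsto_id.atTop_mul_pos (inv_pos.2 hΔ_inf) (hlim.inv₀ hΔ_inf.ne')
  have h1 := (tendsto_nat_floor_div_atTop.comp hTΔ).mul (hlim.mul hTJ)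
  rw [one_mul, ← div_eq_mul_inv] at h1
  refine h1.congr' ?_
  filter_upwards [eventually_gt_atTop 0] with T hT
  have := hΔ T hT
  have := hJ T hT
  rw [div_pow, Real.sq_sqrt (hJ T hT).le]
  simp only [Function.comp]
  field_simp

theorem tendsto_charFun_score_sum {Ω : Type*} [MeasurableSpace Ω] {P : Measure Ω}
    {X : ℝ≥0 → Ω → ℤ} (hX : IsSymmetricCompoundPoisson P ϑ X) (hϑ : 0 < ϑ)
    (hJ : ∀ T, 0 < T → 0 < J T) (hΔ : ∀ T, 0 < T → 0 < Δ T) (hΔ_inf : 0 < Δ_inf)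
    (hlim : Tendsto Δ atTop (𝓝 Δ_inf))
    (hJlim : Tendsto (fun T => J T / T) atTop (𝓝 (Δ_inf * fisherInfo (ϑ * Δ_inf)))) (t : ℝ) :
    Tendsto (fun T => charFun ((observationLaw P X T (Δ T)).map
        fun y => Δ T / √(J T) * ∑ i, score (ϑ * Δ T) (differences y i)) t) atTop
      (𝓝 (charFun (gaussianReal 0 1) t)) := by
  have hx0 : 0 < ϑ * Δ_inf := mul_pos hϑ hΔ_inf
  have hVpos := fisherInfo_pos hx0
  have hκ : 0 < Δ_inf * fisherInfo (ϑ * Δ_inf) := mul_pos hΔ_inf hVpos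
  have ha := tendsto_sq_div_sqrt hJ hκ hJlim hlim
  have hna := tendsto_floor_mul_sq_div_sqrt hJ hκ hJlim hΔ hΔ_inf hlim
  have hx : Tendsto (fun T => ϑ * Δ T) atTop (𝓝 (ϑ * Δ_inf)) := hlim.const_mul ϑ
  have hV : Tendsto (fun T => fisherInfo (ϑ * Δ T)) atTop (𝓝 (fisherInfo (ϑ * Δ_inf))) :=
    (continuousAt_fisherInfo hx0).tendsto.comp hx
  have hL : Δ_inf / (Δ_inf * fisherInfo (ϑ * Δ_inf)) * fisherInfo (ϑ * Δ_inf) = 1 := by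
    rw [div_mul_eq_mul_div, div_self hκ.ne']
  have hnaV := hna.mul hV
  rw [hL] at hnaV
  set a := fun T => Δ T / √(J T)
  set n := fun T => ⌊T / Δ T⌋₊
  set V := fun T => fisherInfo (ϑ * Δ T)
  obtain ⟨K, hK, hS⟩ := exists_score_bounds (c := ϑ * Δ_inf / 2) (C := 2 * (ϑ * Δ_inf))
    (by positivity)
  set M := K ^ 3 * (3 ! * Real.exp 1 * Real.exp (Real.exp 1 * (2 * (ϑ * Δ_inf))))
  have hmain : Tendsto (fun T => Complex.exp ((-(n T * ((t * a T) ^ 2 * V T / 2)) : ℝ))) atTop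
      (𝓝 (charFun (gaussianReal 0 1) t)) := by
    have h1 : Tendsto (fun T => -(n T * ((t * a T) ^ 2 * V T / 2))) atTop (𝓝 (-(t ^ 2 / 2))) := by
      have h := (hnaV.const_mul (t ^ 2 / 2)).neg
      rw [mul_one] at h
      refine h.congr fun T => ?_
      simp only [n, a, V]
      ring
    have h2 := (Complex.continuous_exp.comp Complex.continuous_ofReal).tendsto (-(t ^ 2 / 2))
    rw [charFun_gaussianReal]
    convert h2.comp h1 using 2
    simp only [Function.comp]
    congr 1
    push_cast
    ring
  -- The error bound of `norm_integral_exp_pow_sub_exp_le`, grouped around the convergent `n a²`;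
  -- each term keeps a spare factor `a → 0`.
  have hbound : Tendsto (fun T => 4 * |t| ^ 3 * M * ((n T * a T ^ 2) * |a T|)
      + t ^ 4 / 4 * ((n T * a T ^ 2) * a T ^ 2 * V T ^ 2)) atTop (𝓝 0) := by
    have h1 := (hna.mul ha.abs).const_mul (4 * |t| ^ 3 * M)
    have h2 := ((hna.mul (ha.pow 2)).mul (hV.pow 2)).const_mul (t ^ 4 / 4)
    have h3 := h1.add h2
    simpa using h3
  have hw : Tendsto (fun T => (t * a T) ^ 2 * V T / 2) atTop (𝓝 0) := by
    have := (((ha.const_mul t).pow 2).mul hV).div_const 2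
    simpa using this
  have hdiff : Tendsto (fun T => charFun ((observationLaw P X T (Δ T)).map
        fun y => a T * ∑ i, score (ϑ * Δ T) (differences y i)) t
        - Complex.exp ((-(n T * ((t * a T) ^ 2 * V T / 2)) : ℝ))) atTop (𝓝 0) := by
    refine squeeze_zero_norm' ?_ hbound
    filter_upwards [eventually_gt_atTop 0, hw.eventually_le_const zero_lt_one,
      hx.eventually (Icc_mem_nhds (show ϑ * Δ_inf / 2 < ϑ * Δ_inf by linarith)
        (show ϑ * Δ_inf < 2 * (ϑ * Δ_inf) by linarith))] with T hT hwT hxT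
    have hxT0 : 0 < ϑ * Δ T := mul_pos hϑ (hΔ T hT)
    have := isProbabilityMeasure_skellamMeasure hxT0
    have hf3 : ∀ k, |score (ϑ * Δ T) k ^ 3| ≤ K ^ 3 * absWeight k ^ 3 := fun k =>
      abs_score_pow_le (hS _ hxT k).1 3
    have h3 := integral_abs_le_of_abs_le_absWeight hxT0 hxT.2 (by positivity) hf3
    simp only [abs_pow] at h3
    have h := norm_integral_exp_pow_sub_exp_le (μ := skellamMeasure (ϑ * Δ T))
      (f := score (ϑ * Δ T)) (measurable_of_countable _)
      (integrable_score hxT0) (integrable_score_pow hxT0 2)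
      (by simpa only [abs_pow] using (integrable_score_pow hxT0 3).abs)
      (integral_score hxT0) (u := t * a T) hwT (n T)
    rw [charFun_map_score_sum hX hϑ T (hΔ T hT)]
    refine h.trans ?_
    calc _ ≤ (n T : ℝ) * (4 * |t * a T| ^ 3 * M + ((t * a T) ^ 2 * V T / 2) ^ 2) := by
          gcongr
          exact le_rfl
      _ = _ := by
          have h3 : |a T| ^ 3 = a T ^ 2 * |a T| := by rw [pow_succ, sq_abs]
          rw [abs_mul, mul_pow, h3]
          ring
  have := hdiff.add hmain
  rw [zero_add] at this
  exact this.congr fun T => sub_add_cancel _ _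

/-- Stated for any positive `J` with the right growth rate, so that one proof covers both
normalisations. -/
theorem isLAN_observationLaw {Ω : Type*} [MeasurableSpace Ω] {Θ : Set ℝ} (hΘ : Θ ⊆ Set.Ioi 0)
    {P : ℝ → Measure Ω} {X : ℝ → ℝ≥0 → Ω → ℤ}
    (hX : ∀ ϑ ∈ Θ, IsSymmetricCompoundPoisson (P ϑ) ϑ (X ϑ)) (hϑ : ϑ ∈ Θ)
    (hJ : ∀ T, 0 < T → 0 < J T) (hΔ : ∀ T, 0 < T → 0 < Δ T) (hΔ_inf : 0 < Δ_inf)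
    (hlim : Tendsto Δ atTop (𝓝 Δ_inf))
    (hJlim : Tendsto (fun T => J T / T) atTop (𝓝 (Δ_inf * fisherInfo (ϑ * Δ_inf)))) :
    IsLAN Θ (fun T θ => observationLaw (P θ) (X θ) T (Δ T)) ϑ J := by
  have hϑ0 : 0 < ϑ := hΘ hϑ
  have hx0 : 0 < ϑ * Δ_inf := mul_pos hϑ0 hΔ_inf
  have hVpos := fisherInfo_pos hx0
  have hκ : 0 < Δ_inf * fisherInfo (ϑ * Δ_inf) := mul_pos hΔ_inf hVpos
  have := fun T => (hX ϑ hϑ).isProbabilityMeasure_observationLaw T (Δ T)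
  let ξ : (T : ℝ) → (Fin ⌊T / Δ T⌋₊ → ℤ) → ℝ := fun T y =>
    Δ T / √(J T) * ∑ i, score (ϑ * Δ T) (differences y i)
  have hξ : ∀ T, Measurable (ξ T) := fun T => measurable_of_countable _
  refine ⟨hJ, ξ, hξ, ?_, fun v => ⟨fun T y =>
    llrRemainder (ϑ * Δ T) (v * (Δ T / √(J T))) v (differences y),
    fun T => measurable_of_countable _, ?_, ?_⟩⟩
  · let ρ : ℝ → ProbabilityMeasure ℝ := fun T =>
      ⟨(observationLaw (P ϑ) (X ϑ) T (Δ T)).map (ξ T),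
        Measure.isProbabilityMeasure_map (hξ T).aemeasurable⟩
    have h : Tendsto ρ atTop (𝓝 (⟨gaussianReal 0 1, inferInstance⟩ : ProbabilityMeasure ℝ)) :=
      tendsto_of_tendsto_charFun_atTop fun t =>
        tendsto_charFun_score_sum (hX ϑ hϑ) hϑ0 hJ hΔ hΔ_inf hlim hJlim t
    intro g
    refine (ProbabilityMeasure.tendsto_iff_forall_integral_tendsto.1 h g).congr fun T => ?_
    exact integral_map (hξ T).aemeasurable g.continuous.aestronglyMeasurable
  · intro T hT hmem
    filter_upwards [rnDeriv_observationLaw (hX ϑ hϑ) (hX _ hmem) hϑ0 (hΘ hmem) T (hΔ T hT)]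
      with y hy
    rw [hy]
    congr 1
    have e : (ϑ + v / √(J T)) * Δ T = ϑ * Δ T + v * (Δ T / √(J T)) := by ring
    rw [e]
    simp only [llrRemainder, ξ]
    ring
  · intro δ hδ
    have ha := tendsto_sq_div_sqrt hJ hκ hJlim hlim
    have hna := tendsto_floor_mul_sq_div_sqrt hJ hκ hJlim hΔ hΔ_inf hlim
    have hx : Tendsto (fun T => ϑ * Δ T) atTop (𝓝 (ϑ * Δ_inf)) := hlim.const_mul ϑ
    have hV : Tendsto (fun T => fisherInfo (ϑ * Δ T)) atTop (𝓝 (fisherInfo (ϑ * Δ_inf))) :=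
      (continuousAt_fisherInfo hx0).tendsto.comp hx
    have hL : Δ_inf / (Δ_inf * fisherInfo (ϑ * Δ_inf)) * fisherInfo (ϑ * Δ_inf) = 1 := by
      rw [div_mul_eq_mul_div, div_self hκ.ne']
    have hnaV := hna.mul hV
    rw [hL] at hnaV
    have hva : Tendsto (fun T => v * (Δ T / √(J T))) atTop (𝓝 0) := by
      simpa using ha.const_mul v
    have hxv : Tendsto (fun T => ϑ * Δ T + v * (Δ T / √(J T))) atTop (𝓝 (ϑ * Δ_inf)) := by
      simpa using hx.add hva
    obtain ⟨D, hD, hR⟩ := exists_integral_abs_llrRemainder_le (c := ϑ * Δ_inf / 2)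
      (C := 2 * (ϑ * Δ_inf)) (by positivity)
    have hnhds : Set.Icc (ϑ * Δ_inf / 2) (2 * (ϑ * Δ_inf)) ∈ 𝓝 (ϑ * Δ_inf) :=
      Icc_mem_nhds (by linarith) (by linarith)
    -- The `L¹` bound on the remainder at `δ = vΔ/√J`; Markov's inequality then converts `b → 0`
    -- into convergence in probability.
    set b : ℝ → ℝ := fun T => D * (⌊T / Δ T⌋₊ * |v * (Δ T / √(J T))| ^ 3)
      + |v * (Δ T / √(J T))|
      + |v ^ 2 - ⌊T / Δ T⌋₊ * (v * (Δ T / √(J T))) ^ 2 * fisherInfo (ϑ * Δ T)| / 2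
    have hb : Tendsto b atTop (𝓝 0) := by
      have h1 := ((hna.mul ha.abs).const_mul (D * |v| ^ 3))
      have h2 := hva.abs
      have h3 := (((hnaV.const_mul (v ^ 2)).const_sub (v ^ 2)).abs).div_const 2
      have h4 := (h1.add h2).add h3
      simp only [abs_zero, mul_zero, mul_one, sub_self, zero_div, add_zero] at h4
      refine h4.congr fun T => ?_
      simp only [b]
      congr 2
      · rw [abs_mul, mul_pow, ← sq_abs (Δ T / √(J T))]
        ring
      · congr 1
        ring
    have hb' : Tendsto (fun T => ENNReal.ofReal (b T / δ)) atTop (𝓝 0) := by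
      have := ENNReal.tendsto_ofReal (hb.div_const δ)
      simpa using this
    refine tendsto_of_tendsto_of_tendsto_of_le_of_le' tendsto_const_nhds hb'
      (Eventually.of_forall fun T => zero_le) ?_
    filter_upwards [eventually_gt_atTop 0, hx.eventually hnhds, hxv.eventually hnhds]
      with T hT hxT hxvT
    obtain ⟨hi, hle⟩ := hR _ hxT _ hxvT ⌊T / Δ T⌋₊ v
    have hmap := map_differences_observationLaw (hX ϑ hϑ) hϑ0 T (hΔ T hT)
    have := isProbabilityMeasure_skellamMeasure (mul_pos hϑ0 (hΔ T hT))
    have hset : observationLaw (P ϑ) (X ϑ) T (Δ T)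
          {y | δ ≤ |llrRemainder (ϑ * Δ T) (v * (Δ T / √(J T))) v (differences y)|}
        = (Measure.pi fun _ => skellamMeasure (ϑ * Δ T))
          {d : Fin ⌊T / Δ T⌋₊ → ℤ | δ ≤ |llrRemainder (ϑ * Δ T) (v * (Δ T / √(J T))) v d|} := by
      rw [← hmap, Measure.map_apply (measurable_of_countable _) (Set.to_countable _).measurableSet]
      rfl
    have hmarkov := mul_meas_ge_le_integral_of_nonneg
      (Eventually.of_forall fun d => abs_nonneg _) hi.abs δ
    rw [hset, ← ofReal_measureReal]
    refine ENNReal.ofReal_le_ofReal ?_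
    rw [le_div_iff₀ hδ, mul_comm]
    exact hmarkov.trans hle

end Asymptotics

theorem theorem1 {Ω : Type*} [MeasurableSpace Ω]
    (Θ : Set ℝ) (hΘ : Θ ⊆ Set.Ioi 0) (hΘ_int : (interior Θ).Nonempty)
    (P : ℝ → Measure Ω) (X : ℝ → ℝ≥0 → Ω → ℤ)
    (hX : ∀ ϑ ∈ Θ, IsSymmetricCompoundPoisson (P ϑ) ϑ (X ϑ))
    (Δ : ℝ → ℝ) (hΔ : ∀ T, 0 < T → 0 < Δ T ∧ Δ T ≤ T)
    (Δ_inf : ℝ) (hΔ_inf : 0 < Δ_inf) (hlim : Tendsto Δ atTop (𝓝 Δ_inf)) :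
    ∀ ϑ ∈ Θ,
      IsLAN Θ (fun T θ => observationLaw (P θ) (X θ) T (Δ T)) ϑ
        (fun T => scaleInformation (P ϑ) (X ϑ) T (Δ T) ϑ) ∧
      (fun T => scaleInformation (P ϑ) (X ϑ) T (Δ T) ϑ) ~[atTop]
        (fun T => scaleInformation (P ϑ) (X ϑ) T Δ_inf ϑ) ∧
      IsLAN Θ (fun T θ => observationLaw (P θ) (X θ) T (Δ T)) ϑ
        (fun T => scaleInformation (P ϑ) (X ϑ) T Δ_inf ϑ) := by
  intro ϑ hϑ
  have hϑ0 : 0 < ϑ := hΘ hϑ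
  have hx0 : 0 < ϑ * Δ_inf := mul_pos hϑ0 hΔ_inf
  have hκ : 0 < Δ_inf * fisherInfo (ϑ * Δ_inf) := mul_pos hΔ_inf (fisherInfo_pos hx0)
  have hΔ0 : ∀ T, 0 < T → 0 < Δ T := fun T hT => (hΔ T hT).1
  have e₁ : ∀ T, 0 < T → scaleInformation (P ϑ) (X ϑ) T (Δ T) ϑ
      = T * Δ T * fisherInfo (ϑ * Δ T) := fun T hT =>
    scaleInformation_eq (hX ϑ hϑ) hϑ0 T (hΔ0 T hT)
  have e₂ : ∀ T, scaleInformation (P ϑ) (X ϑ) T Δ_inf ϑ = T * Δ_inf * fisherInfo (ϑ * Δ_inf) :=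
    fun T => scaleInformation_eq (hX ϑ hϑ) hϑ0 T hΔ_inf
  have pos₁ : ∀ T, 0 < T → 0 < scaleInformation (P ϑ) (X ϑ) T (Δ T) ϑ := fun T hT => by
    have h1 := hΔ0 T hT
    have h2 := fisherInfo_pos (mul_pos hϑ0 h1)
    rw [e₁ T hT]
    positivity
  have pos₂ : ∀ T, 0 < T → 0 < scaleInformation (P ϑ) (X ϑ) T Δ_inf ϑ := fun T hT => by
    rw [e₂, mul_assoc]
    positivity
  have lim₁ : Tendsto (fun T => scaleInformation (P ϑ) (X ϑ) T (Δ T) ϑ / T) atTop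
      (𝓝 (Δ_inf * fisherInfo (ϑ * Δ_inf))) := by
    refine (hlim.mul ((continuousAt_fisherInfo hx0).tendsto.comp (hlim.const_mul ϑ))).congr' ?_
    filter_upwards [eventually_gt_atTop 0] with T hT
    rw [e₁ T hT]
    simp only [Function.comp]
    field_simp
  have lim₂ : Tendsto (fun T => scaleInformation (P ϑ) (X ϑ) T Δ_inf ϑ / T) atTop
      (𝓝 (Δ_inf * fisherInfo (ϑ * Δ_inf))) := by
    refine tendsto_const_nhds.congr' ?_
    filter_upwards [eventually_gt_atTop 0] with T hT
    rw [e₂]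
    field_simp
  refine ⟨isLAN_observationLaw hΘ hX hϑ pos₁ hΔ0 hΔ_inf hlim lim₁, ?_,
    isLAN_observationLaw hΘ hX hϑ pos₂ hΔ0 hΔ_inf hlim lim₂⟩
  refine (isEquivalent_iff_tendsto_one ?_).2 ?_
  · filter_upwards [eventually_gt_atTop 0] with T hT using (pos₂ T hT).ne'
  · have h := lim₁.div lim₂ hκ.ne'
    rw [div_self hκ.ne'] at h
    refine h.congr' ?_
    filter_upwards [eventually_gt_atTop 0] with T hT
    have := pos₂ T hT
    simp only [Pi.div_apply]
    field_simp
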